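/- Let $K$ be a field, let $V_0,\dots,V_n$ be $K$-vector spaces of finite dimensions $d_0,\dots,d_n$, and let $r=(r_1,\dots,r_n)\in\mathbb N^n$, with the convention $r_0=r_{n+1}=0$. Let $\mathcal C_r$ be the variety of sequences $V_0\xrightarrow{f_1}V_1\xrightarrow{f_2}\cdots\xrightarrow{f_n}V_n$ of linear maps with $f_{i+1}\circ f_i=0$ for $1\le i\le n-1$ and $\operatorname{rank}(f_i)=r_i$ for $1\le i\le n$. It is a locally closed subvariety of the affine space $\prod_{i=1}^n\operatorname{Hom}_K(V_{i-1},V_i)$, and is given its reduced scheme structure over $K$; its scheme points are the points of the affine space over whose residue field the corresponding linear maps satisfy these conditions. a) $\mathcal C_r\neq\emptyset$ if and only if $r_{i+1}+r_i\le d_i$ for all $0\le i\le n$. This holds both for the set of $K$-rational points of $\mathcal C_r$ and for the scheme $\mathcal C_r$. b) If the conditions in a) hold, then $\mathcal C_r$ is smooth over $K$ and irreducible, of dimension $$\dim(\mathcal C_r)=\sum_{i=0}^n(d_i-r_i)(r_{i+1}+r_i)=\sum_{i=0}^n(d_i-r_i)(d_i-h_i)=\frac12\sum_{i=0}^n(d_i^2-h_i^2),$$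 where $h_i=\dim_K\bigl(\ker f_{i+1}/\operatorname{im} f_i\bigr)$ is the dimension of the $i$-th homology of any complex $f\in\mathcal C_r(K)$ (with $\operatorname{im} f_0=0$ and $\ker f_{n+1}=V_n$). -/

import Mathlib

open scoped TensorProduct

noncomputable section

namespace VarietyOfComplexes

universe u v

/-! ### Complexes of vector spaces with prescribed ranks -/

section Complexes

variable (K : Type u) [Field K] {n : ℕ} (V : Fin (n + 1) → Type v)
  [∀ i, AddCommGroup (V i)] [∀ i, Module K (V i)]

/-- Sequences of linear maps `V 0 → V 1 → ⋯ → V n`. The entry `f i`, for `i : Fin n`, is the map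
from the `i`-th to the `(i + 1)`-st space. -/
abbrev MapSeq : Type _ := ∀ i : Fin n, V i.castSucc →ₗ[K] V i.succ

/-- The set `𝒞 = 𝒞(V 0, …, V n)` of differential complexes: consecutive maps compose to zero. -/
def complexes : Set (MapSeq K V) :=
  {f | ∀ (i : ℕ) (hi : i + 1 < n) (x : V (Fin.castSucc ⟨i, by omega⟩)),
    f ⟨i + 1, hi⟩ (f ⟨i, by omega⟩ x) = 0}

/-- The set `𝒞_r` of complexes whose maps have ranks `r = (r_1, …, r_n)`; here `r i` is the rank
prescribed for the map from the `i`-th to the `(i + 1)`-st space. -/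
def rankStratum (r : Fin n → ℕ) : Set (MapSeq K V) :=
  {f | f ∈ complexes K V ∧ ∀ i, Module.finrank K (LinearMap.range (f i)) = r i}

variable {K V}

/-- The boundaries `B_i = im (V (i - 1) → V i)`, with `B_0 = 0`. -/
def boundaries (f : MapSeq K V) (i : Fin (n + 1)) : Submodule K (V i) :=
  Fin.cases (motive := fun i => Submodule K (V i)) ⊥ (fun j => LinearMap.range (f j)) i

/-- The cycles `Z_i = ker (V i → V (i + 1))`, with `Z_n = V n`. -/
def cycles (f : MapSeq K V) (i : Fin (n + 1)) : Submodule K (V i) :=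
  Fin.lastCases (motive := fun i => Submodule K (V i)) ⊤ (fun j => LinearMap.ker (f j)) i

/-- The dimension `h_i` of the homology `H_i = Z_i / B_i`. -/
def homologyDim (f : MapSeq K V) (i : Fin (n + 1)) : ℕ :=
  Module.finrank K (cycles f i ⧸ (boundaries f i).submoduleOf (cycles f i))

end Complexes

/-- The sequence `r_0, r_1, …, r_n, r_{n+1}, …` attached to `(r_1, …, r_n)` by the convention
`r_0 = 0` and `r_j = 0` for `j > n`. -/
def extendRank {n : ℕ} (r : Fin n → ℕ) : ℕ → ℕ
  | 0 => 0
  | j + 1 => if h : j < n then r ⟨j, h⟩ else 0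

/-! ### The locally closed subvariety `𝒞_r` of the affine space of sequences of linear maps -/

section Scheme

variable {K : Type u} [Field K] {n : ℕ} {V : Fin (n + 1) → Type v}
  [∀ i, AddCommGroup (V i)] [∀ i, Module K (V i)] {d : Fin (n + 1) → ℕ}

/-- Index set of the matrix entries of a sequence of linear maps between spaces of dimensions
`d 0, …, d n`. -/
abbrev Coord (d : Fin (n + 1) → ℕ) : Type := Σ i : Fin n, Fin (d i.succ) × Fin (d i.castSucc)

variable (K d) in
/-- The coordinate ring of the affine space `V = ∏ Hom(V (i - 1), V i)`, in the linear coordinates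
given by matrix entries. -/
abbrev CoordRing : Type u := MvPolynomial (Coord d) K

/-- The matrix, with entries in the residue field of the point `p` of the affine space, of the
`i`-th linear map that the point `p` represents. -/
def pointMatrix (p : PrimeSpectrum (CoordRing K d)) (i : Fin n) :
    Matrix (Fin (d i.succ)) (Fin (d i.castSucc)) p.asIdeal.ResidueField :=
  Matrix.of fun a c => algebraMap (CoordRing K d) _ (MvPolynomial.X ⟨i, a, c⟩)

/-- The sequence of linear maps over the residue field `κ` of `p`, between the base changes
`κ ⊗ V i`, that a point `p` of the affine space represents; `b i` is the basis of `V i` used for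
the coordinates. -/
def pointMaps (b : ∀ i, Module.Basis (Fin (d i)) K (V i)) (p : PrimeSpectrum (CoordRing K d)) :
    MapSeq p.asIdeal.ResidueField (fun i => p.asIdeal.ResidueField ⊗[K] V i) :=
  fun i => Matrix.toLin ((b i.castSucc).baseChange p.asIdeal.ResidueField)
    ((b i.succ).baseChange p.asIdeal.ResidueField) (pointMatrix p i)

/-- The set of (scheme-theoretic) points of `𝒞_r` in the affine space: those for which the maps
over the residue field form a complex with ranks `r`. -/
def stratumPoints (b : ∀ i, Module.Basis (Fin (d i)) K (V i)) (r : Fin n → ℕ) :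
    Set (PrimeSpectrum (CoordRing K d)) :=
  {p | pointMaps b p ∈ rankStratum p.asIdeal.ResidueField
    (fun i => p.asIdeal.ResidueField ⊗[K] V i) r}

/-- The ideal of all functions vanishing on `𝒞_r`. -/
def stratumIdeal (b : ∀ i, Module.Basis (Fin (d i)) K (V i)) (r : Fin n → ℕ) :
    Ideal (CoordRing K d) :=
  PrimeSpectrum.vanishingIdeal (stratumPoints b r)

/-! #### Local closedness of the set of points of `𝒞_r` -/

theorem exists_minor {L : Type*} [Field L] {m k : ℕ} (M : Matrix (Fin m) (Fin k) L) :
    ∃ (e : Fin M.rank → Fin m) (c : Fin M.rank → Fin k), (M.submatrix e c).det ≠ 0 := by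
  have key : ∀ {m k s : ℕ} (M : Matrix (Fin m) (Fin k) L), M.rank = s →
      ∃ e : Fin s → Fin m, LinearIndependent L (M.submatrix e id).row := by
    intro m k s M hs
    have hex := Submodule.exists_fun_fin_finrank_span_eq L (Set.range M.row)
    rw [← M.rank_eq_finrank_span_row, hs] at hex
    obtain ⟨g, hg, -, hgi⟩ := hex
    choose e he using hg
    refine ⟨e, ?_⟩
    have : (M.submatrix e id).row = g := by
      funext i
      rw [← he i]
      rfl
    rwa [this]
  obtain ⟨e, he⟩ := key M rfl
  have h1 : (M.submatrix e id).transpose.rank = M.rank := by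
    rw [Matrix.rank_transpose, he.rank_matrix, Fintype.card_fin]
  obtain ⟨c, hc⟩ := key _ h1
  refine ⟨e, c, ?_⟩
  rw [Matrix.linearIndependent_rows_iff_isUnit, Matrix.isUnit_iff_isUnit_det] at hc
  have : (M.submatrix e c) = (((M.submatrix e id).transpose).submatrix c id).transpose := rfl
  rw [this, Matrix.det_transpose]
  exact hc.ne_zero

variable (K d) in
/-- The universal matrix over the coordinate ring. -/
def genericMatrix (i : Fin n) :
    Matrix (Fin (d i.succ)) (Fin (d i.castSucc)) (CoordRing K d) :=
  Matrix.of fun a c => MvPolynomial.X ⟨i, a, c⟩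

theorem pointMatrix_eq_map (p : PrimeSpectrum (CoordRing K d)) (i : Fin n) :
    pointMatrix p i = (genericMatrix K d i).map (algebraMap _ p.asIdeal.ResidueField) := rfl

theorem finrank_range_pointMaps (b : ∀ i, Module.Basis (Fin (d i)) K (V i))
    (p : PrimeSpectrum (CoordRing K d)) (i : Fin n) :
    Module.finrank p.asIdeal.ResidueField (LinearMap.range (pointMaps b p i)) =
      (pointMatrix p i).rank :=
  ((pointMatrix p i).rank_eq_finrank_range_toLin _ _).symm

theorem isOpen_le_rank (i : Fin n) (k : ℕ) :
    IsOpen {p : PrimeSpectrum (CoordRing K d) | k ≤ (pointMatrix p i).rank} := by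
  rw [isOpen_iff_forall_mem_open]
  intro p hp
  obtain ⟨e, c, hdet⟩ := exists_minor (pointMatrix p i)
  have hmap : ∀ q : PrimeSpectrum (CoordRing K d), ((pointMatrix q i).submatrix e c).det =
      algebraMap _ q.asIdeal.ResidueField ((genericMatrix K d i).submatrix e c).det := by
    intro q
    rw [RingHom.map_det]
    rfl
  have hmem : ∀ q : PrimeSpectrum (CoordRing K d),
      ((pointMatrix q i).submatrix e c).det ≠ 0 ↔
        ((genericMatrix K d i).submatrix e c).det ∉ q.asIdeal := by
    intro q
    rw [hmap, Ne, Ideal.algebraMap_residueField_eq_zero]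
  refine ⟨PrimeSpectrum.basicOpen ((genericMatrix K d i).submatrix e c).det, ?_,
    (PrimeSpectrum.basicOpen _).isOpen, (hmem p).1 hdet⟩
  intro q hq
  have hq' := (hmem q).2 hq
  refine le_trans (show k ≤ (pointMatrix p i).rank from hp) ?_
  have h2 := Matrix.rank_of_isUnit _ ((Matrix.isUnit_iff_isUnit_det _).2 hq'.isUnit)
  rw [Fintype.card_fin] at h2
  rw [← h2]
  exact Matrix.rank_submatrix_le _ _ _

theorem toLin_mem_complexes_iff (b : ∀ i, Module.Basis (Fin (d i)) K (V i))
    (M : ∀ i : Fin n, Matrix (Fin (d i.succ)) (Fin (d i.castSucc)) K) :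
    (fun i => Matrix.toLin (b i.castSucc) (b i.succ) (M i) : MapSeq K V) ∈ complexes K V ↔
      ∀ (i : ℕ) (hi : i + 1 < n) (a : Fin (d (Fin.succ ⟨i + 1, hi⟩)))
        (c : Fin (d (Fin.castSucc ⟨i, Nat.lt_of_succ_lt hi⟩))),
        ∑ j : Fin (d (Fin.castSucc ⟨i + 1, hi⟩)), M ⟨i + 1, hi⟩ a j *
          M ⟨i, Nat.lt_of_succ_lt hi⟩ j c = 0 := by
  refine forall₂_congr fun i hi => ?_
  set B : Matrix (Fin (d (Fin.castSucc ⟨i + 1, hi⟩)))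
    (Fin (d (Fin.castSucc ⟨i, Nat.lt_of_succ_lt hi⟩))) K := M ⟨i, Nat.lt_of_succ_lt hi⟩ with hB
  have hmul := Matrix.toLin_mul (b (Fin.castSucc ⟨i, Nat.lt_of_succ_lt hi⟩))
    (b (Fin.castSucc ⟨i + 1, hi⟩)) (b (Fin.succ ⟨i + 1, hi⟩)) (M ⟨i + 1, hi⟩) B
  have h2 := (Matrix.toLin (b (Fin.castSucc ⟨i, Nat.lt_of_succ_lt hi⟩))
    (b (Fin.succ ⟨i + 1, hi⟩))).map_eq_zero_iff (x := M ⟨i + 1, hi⟩ * B)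
  rw [hmul, LinearMap.ext_iff, ← Matrix.ext_iff] at h2
  exact h2

theorem pointMaps_mem_complexes_iff (b : ∀ i, Module.Basis (Fin (d i)) K (V i))
    (p : PrimeSpectrum (CoordRing K d)) :
    pointMaps b p ∈ complexes p.asIdeal.ResidueField (fun i => p.asIdeal.ResidueField ⊗[K] V i) ↔
      ∀ (i : ℕ) (hi : i + 1 < n) (a : Fin (d (Fin.succ ⟨i + 1, hi⟩)))
        (c : Fin (d (Fin.castSucc ⟨i, Nat.lt_of_succ_lt hi⟩))),
        ∑ j : Fin (d (Fin.castSucc ⟨i + 1, hi⟩)), genericMatrix K d ⟨i + 1, hi⟩ a j *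
          genericMatrix K d ⟨i, Nat.lt_of_succ_lt hi⟩ j c ∈ p.asIdeal := by
  refine (toLin_mem_complexes_iff
    (fun i => (b i).baseChange p.asIdeal.ResidueField) (pointMatrix p)).trans ?_
  refine forall₂_congr fun i hi => forall₂_congr fun a c => ?_
  rw [← Ideal.algebraMap_residueField_eq_zero, map_sum]
  simp only [map_mul]
  rfl

theorem isClosed_complex (b : ∀ i, Module.Basis (Fin (d i)) K (V i)) :
    IsClosed {p : PrimeSpectrum (CoordRing K d) | pointMaps b p ∈
      complexes p.asIdeal.ResidueField (fun i => p.asIdeal.ResidueField ⊗[K] V i)} := by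
  simp only [pointMaps_mem_complexes_iff, Set.ofPred_forall]
  refine isClosed_iInter fun i => isClosed_iInter fun hi => isClosed_iInter fun a =>
    isClosed_iInter fun c => ?_
  convert PrimeSpectrum.isClosed_zeroLocus (R := CoordRing K d)
    {∑ j : Fin (d (Fin.castSucc ⟨i + 1, hi⟩)), genericMatrix K d ⟨i + 1, hi⟩ a j *
          genericMatrix K d ⟨i, Nat.lt_of_succ_lt hi⟩ j c} using 1
  ext p
  simp [PrimeSpectrum.mem_zeroLocus]

theorem isOpen_preimage_stratumPoints (b : ∀ i, Module.Basis (Fin (d i)) K (V i))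
    (r : Fin n → ℕ) :
    IsOpen (PrimeSpectrum.comap (Ideal.Quotient.mk (stratumIdeal b r)) ⁻¹' stratumPoints b r) := by
  set F : Set (PrimeSpectrum (CoordRing K d)) :=
    {p | pointMaps b p ∈
      complexes p.asIdeal.ResidueField (fun i => p.asIdeal.ResidueField ⊗[K] V i)} ∩
      ⋂ i, {p | r i + 1 ≤ (pointMatrix p i).rank}ᶜ with hF
  set W : Set (PrimeSpectrum (CoordRing K d)) :=
    ⋂ i, {p | r i ≤ (pointMatrix p i).rank} with hW
  have hFc : IsClosed F := (isClosed_complex b).inter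
    (isClosed_iInter fun i => (isOpen_le_rank i _).isClosed_compl)
  have hWo : IsOpen W := isOpen_iInter_of_finite fun i => isOpen_le_rank i _
  have hS : stratumPoints b r = F ∩ W := by
    ext p
    simp only [stratumPoints, rankStratum, Set.mem_ofPred_eq, finrank_range_pointMaps, hF, hW,
      Set.mem_inter_iff, Set.mem_iInter, Set.mem_compl_iff, and_assoc, ← forall_and]
    refine and_congr_right fun _ => forall_congr' fun i => ?_
    omega
  have hsub : PrimeSpectrum.comap (Ideal.Quotient.mk (stratumIdeal b r)) ⁻¹' stratumPoints b r =
      PrimeSpectrum.comap (Ideal.Quotient.mk (stratumIdeal b r)) ⁻¹' W := by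
    ext q
    refine ⟨fun h => (hS ▸ h : _ ∈ F ∩ W).2, fun h => ?_⟩
    show _ ∈ stratumPoints b r
    rw [hS]
    refine ⟨?_, h⟩
    have hcl : closure (stratumPoints b r) ⊆ F :=
      closure_minimal (hS ▸ Set.inter_subset_left) hFc
    apply hcl
    rw [← PrimeSpectrum.zeroLocus_vanishingIdeal_eq_closure, PrimeSpectrum.mem_zeroLocus]
    intro x hx
    have : Ideal.Quotient.mk (stratumIdeal b r) x = 0 := Ideal.Quotient.eq_zero_iff_mem.2 hx
    simp [PrimeSpectrum.comap_asIdeal, this]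
  rw [hsub]
  exact hWo.preimage (PrimeSpectrum.continuous_comap _)

/-! #### `𝒞_r` as a scheme over `K` -/

open AlgebraicGeometry CategoryTheory

/-- `𝒞_r` as an open subset of its closure, the latter carrying its reduced structure. -/
def stratumOpens (b : ∀ i, Module.Basis (Fin (d i)) K (V i)) (r : Fin n → ℕ) :
    (Spec (CommRingCat.of (CoordRing K d ⧸ stratumIdeal b r))).Opens :=
  ⟨PrimeSpectrum.comap (Ideal.Quotient.mk (stratumIdeal b r)) ⁻¹' stratumPoints b r,
    isOpen_preimage_stratumPoints b r⟩

/-- The variety `𝒞_r`: the locally closed subset `stratumPoints b r` of the affine space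
`∏ Hom(V (i - 1), V i)` with its reduced scheme structure. -/
def stratum (b : ∀ i, Module.Basis (Fin (d i)) K (V i)) (r : Fin n → ℕ) : Scheme.{u} :=
  (stratumOpens b r).toScheme

/-- The structure morphism of the variety `𝒞_r` over the ground field. -/
def stratumToSpec (b : ∀ i, Module.Basis (Fin (d i)) K (V i)) (r : Fin n → ℕ) :
    stratum b r ⟶ Spec (CommRingCat.of K) :=
  (stratumOpens b r).ι ≫
    Spec.map (CommRingCat.ofHom (algebraMap K (CoordRing K d ⧸ stratumIdeal b r)))

end Scheme

end VarietyOfComplexes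

end

/-!
The variety of complexes is covered by open subschemes of affine spaces, written down explicitly.
Fix, at every vertex `v`, a splitting of the coordinates into `m v = r_v` of them and the rest. As
long as the boundaries at `v` project isomorphically to the first group, they are the graph of a
matrix `N v`, and the `i`-th map of a complex is a product
`(1; N (i + 1)) * W i * (-N i, 1)`: project along the boundaries, apply `W i`, include the
boundaries. Conversely every choice of the matrices `N` and `W` gives a complex
(`Chart.isComplex_maps`), whose ranks are the prescribed ones if every `W i` has an invertible
maximal minor (`Chart.rank_maps`). Fixing the places of these minors makes `N` a rational function
of the complex (`Chart.exists_maps_eq`), and the charts for all choices of splittings and minors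
cover the variety (`Chart.exists_pivotDet_ne_zero`). So a chart is a principal open subset of the affine space with coordinates `N` and `W`, and it is also the open subset of the
reduced closure of the variety where the product of the chosen minors is invertible
(`Chart.isLocalization_awayHom`).

Smoothness follows at once (`smooth_stratumToSpec`). The number of chart coordinates is the
dimension (`topologicalKrullDim_stratum`): it bounds the dimension of every chart, and the standard
complex is a rational point in a chart, from which a flag of linear subspaces gives a chain of
irreducible closed subsets of the required length (`le_ringKrullDim_away`).

The variety is irreducible because its points are the points of an irreducible set satisfying an
open condition: letting invertible matrices `g v` move the boundaries, every complex has the form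
`g (i + 1) * (inclusion * W i * projection) * (g i)⁻¹`. With the adjugate instead of the inverse
this formula makes sense for all square matrices and defines a morphism from an affine space
(`stratumPoints_eq_range_inter`).

The inequalities are necessary, over any field, since the boundaries are contained in the cycles
(`extendRank_add_le`).
-/

noncomputable section

namespace VarietyOfComplexes

/-! ### Ranks and minors of matrices over a field -/

section Minors

variable {L : Type*} [Field L]

/-- A matrix of rank `s` has `s` linearly independent rows. -/
theorem exists_linearIndependent_rows {p q s : ℕ} (M : Matrix (Fin p) (Fin q) L)
    (hM : M.rank = s) :
    ∃ e : Fin s → Fin p, LinearIndependent L (M.submatrix e id).row := by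
  subst hM
  obtain ⟨e, c, h⟩ := exists_minor M
  refine ⟨e, LinearIndependent.of_comp (LinearMap.funLeft L L c) ?_⟩
  exact Matrix.linearIndependent_rows_iff_isUnit.2
    ((Matrix.isUnit_iff_isUnit_det _).2 h.isUnit)

/-- A matrix with linearly independent rows has a nonvanishing maximal minor. -/
theorem exists_det_submatrix_ne_zero {s q : ℕ} (M : Matrix (Fin s) (Fin q) L)
    (hM : LinearIndependent L M.row) : ∃ c : Fin s → Fin q, (M.submatrix id c).det ≠ 0 := by
  have h : M.transpose.rank = s := by
    rw [Matrix.rank_transpose, hM.rank_matrix, Fintype.card_fin]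
  obtain ⟨c, hc⟩ := exists_linearIndependent_rows _ h
  refine ⟨c, ?_⟩
  rw [← Matrix.det_transpose]
  exact ((Matrix.isUnit_iff_isUnit_det _).1
    (Matrix.linearIndependent_rows_iff_isUnit.1 hc)).ne_zero

theorem card_le_rank_of_det_submatrix_ne_zero {p q s : Type*} [Fintype q] [Fintype s]
    [DecidableEq s] (M : Matrix p q L) (e : s → p) (c : s → q)
    (h : (M.submatrix e c).det ≠ 0) : Fintype.card s ≤ M.rank := by
  rw [← Matrix.rank_of_isUnit _ ((Matrix.isUnit_iff_isUnit_det _).2 h.isUnit)]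
  exact Matrix.rank_submatrix_le _ _ _

/-- The rank of a matrix does not change under extension of the field. -/
theorem rank_map_of_field {L' : Type*} [Field L'] (f : L →+* L') {p q : ℕ}
    (M : Matrix (Fin p) (Fin q) L) : (M.map f).rank = M.rank := by
  apply le_antisymm
  · obtain ⟨e, c, h⟩ := exists_minor (M.map f)
    have h' : (M.submatrix e c).det ≠ 0 := by
      intro h0
      apply h
      have := f.map_det (M.submatrix e c)
      rw [h0, map_zero] at this
      exact this.symm
    simpa using card_le_rank_of_det_submatrix_ne_zero M e c h'
  · obtain ⟨e, c, h⟩ := exists_minor M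
    have h' : ((M.map f).submatrix e c).det ≠ 0 := by
      have := f.map_det (M.submatrix e c)
      intro h0
      exact h ((map_eq_zero f).1 (this.trans h0))
    simpa using card_le_rank_of_det_submatrix_ne_zero (M.map f) e c h'

/-- If the minor of `M` with rows `e` and columns `c` does not vanish and has the size of the rank
of `M`, then `M` is recovered from its rows `e` and its columns `c`. -/
theorem eq_mul_inv_mul_of_rank_le {p q s : Type*} [Fintype p] [Fintype q] [Fintype s]
    [DecidableEq s] [DecidableEq q] (M : Matrix p q L) (e : s → p) (c : s → q)
    (h : (M.submatrix e c).det ≠ 0) (hr : M.rank ≤ Fintype.card s) :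
    M = M.submatrix id c * (M.submatrix e c)⁻¹ * M.submatrix e id := by
  classical
  set C := M.submatrix id c with hC
  have hle : LinearMap.range C.mulVecLin ≤ LinearMap.range M.mulVecLin := by
    rw [Matrix.range_mulVecLin, Matrix.range_mulVecLin]
    apply Submodule.span_mono
    rintro _ ⟨k, rfl⟩
    exact ⟨c k, rfl⟩
  have heq : LinearMap.range C.mulVecLin = LinearMap.range M.mulVecLin := by
    apply Submodule.eq_of_le_of_finrank_le hle
    exact hr.trans (card_le_rank_of_det_submatrix_ne_zero C e id h)
  have hX : ∀ k : q, ∃ x : s → L, C.mulVec x = M.col k := by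
    intro k
    have : M.col k ∈ LinearMap.range C.mulVecLin := by
      rw [heq, Matrix.range_mulVecLin]
      exact Submodule.subset_span ⟨k, rfl⟩
    exact this
  choose x hx using hX
  have hMX : M = C * (Matrix.of x).transpose := by
    ext a k
    exact (congrFun (hx k) a).symm
  have hrow : M.submatrix e id = M.submatrix e c * (Matrix.of x).transpose := by
    conv_lhs => rw [hMX]
    rfl
  rw [hrow, Matrix.mul_assoc, Matrix.nonsing_inv_mul_cancel_left _ _ h.isUnit]
  exact hMX

end Minors

/-! ### Charts of the variety of complexes -/

/-- Sequences of matrices, with entries in `R`, of the shapes of linear maps between spaces of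
dimensions `d 0, …, d n`. -/
abbrev MatSeq {n : ℕ} (d : Fin (n + 1) → ℕ) (R : Type*) : Type _ :=
  ∀ i : Fin n, Matrix (Fin (d i.succ)) (Fin (d i.castSucc)) R

/-- The matrix preceding the `(i + 1)`-st one, with its rows indexed by the columns of that one. -/
abbrev MatSeq.before {n : ℕ} {d : Fin (n + 1) → ℕ} {R : Type*} (M : MatSeq d R) (i : ℕ)
    (hi : i + 1 < n) : Matrix (Fin (d (Fin.castSucc ⟨i + 1, hi⟩)))
      (Fin (d (Fin.castSucc ⟨i, Nat.lt_of_succ_lt hi⟩))) R :=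
  M ⟨i, Nat.lt_of_succ_lt hi⟩

/-- Consecutive matrices have product zero. -/
def MatSeq.IsComplex {n : ℕ} {d : Fin (n + 1) → ℕ} {R : Type*} [CommRing R] (M : MatSeq d R) :
    Prop :=
  ∀ (i : ℕ) (hi : i + 1 < n), M ⟨i + 1, hi⟩ * M.before i hi = 0

/-- The discrete data of a chart of the variety of complexes with ranks `m 1, …, m n`. For every
vertex `v`, a set of `m v` coordinates of the `v`-th space is chosen, namely the image of `Sum.inl`
under `split v`; on the chart the projection of the boundaries to these coordinates is bijective.
For every arrow `i`, a family `pivot i` of `m (i + 1)` of the remaining coordinates of the source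
is chosen; on the chart the columns of the `i`-th matrix at these places span its column space. The
family need not be injective: if it is not, the chart is empty. -/
structure Chart {n : ℕ} (d : Fin (n + 1) → ℕ) (m : ℕ → ℕ) where
  /-- Splitting of the coordinates at the vertex `v`. -/
  split : ∀ v : Fin (n + 1), Fin (m v) ⊕ Fin (d v - m v) ≃ Fin (d v)
  /-- The pivot columns of the `i`-th matrix. -/
  pivot : ∀ i : Fin n, Fin (m i.succ) → Fin (d i.castSucc - m i.castSucc)

/-- Index set of the coordinates on a chart: the entries of a matrix `N v` of size
`(d v - m v) × m v` for every vertex `v`, and of a matrix `W i` of size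
`m (i + 1) × (d i - m i)` for every arrow `i`. -/
abbrev ParamIdx {n : ℕ} (d : Fin (n + 1) → ℕ) (m : ℕ → ℕ) : Type :=
  (Σ v : Fin (n + 1), Fin (d v - m v) × Fin (m v)) ⊕
    (Σ i : Fin n, Fin (m i.succ) × Fin (d i.castSucc - m i.castSucc))

section Param

variable {n : ℕ} {d : Fin (n + 1) → ℕ} {m : ℕ → ℕ} {R : Type*}

/-- The matrix `N v` with entries given by the chart coordinates `x`. -/
def paramN (x : ParamIdx d m → R) (v : Fin (n + 1)) : Matrix (Fin (d v - m v)) (Fin (m v)) R :=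
  Matrix.of fun a b => x (Sum.inl ⟨v, a, b⟩)

/-- The matrix `W i` with entries given by the chart coordinates `x`. -/
def paramW (x : ParamIdx d m → R) (i : Fin n) :
    Matrix (Fin (m i.succ)) (Fin (d i.castSucc - m i.castSucc)) R :=
  Matrix.of fun a b => x (Sum.inr ⟨i, a, b⟩)

end Param

namespace Chart

variable {n : ℕ} {d : Fin (n + 1) → ℕ} {m : ℕ → ℕ} {R : Type*} [CommRing R] (c : Chart d m)

/-- The matrix whose columns are a basis of the graph of `N`, a complement of the second summand
in the splitting of the `v`-th space. -/
def graphCols (v : Fin (n + 1)) (N : Matrix (Fin (d v - m v)) (Fin (m v)) R) :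
    Matrix (Fin (d v)) (Fin (m v)) R :=
  (Matrix.fromRows 1 N).submatrix (c.split v).symm id

/-- The matrix whose rows are equations of the graph of `N`. -/
def graphEqns (v : Fin (n + 1)) (N : Matrix (Fin (d v - m v)) (Fin (m v)) R) :
    Matrix (Fin (d v - m v)) (Fin (d v)) R :=
  (Matrix.fromCols (-N) 1).submatrix id (c.split v).symm

theorem graphEqns_mul_graphCols (v : Fin (n + 1)) (N : Matrix (Fin (d v - m v)) (Fin (m v)) R) :
    c.graphEqns v N * c.graphCols v N = 0 := by
  rw [graphEqns, graphCols, Matrix.submatrix_mul_equiv, Matrix.fromCols_mul_fromRows]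
  simp

/-- A matrix that annihilates the graph of `N` factors through the equations of the graph. -/
theorem eq_mul_graphEqns {p : Type*} (v : Fin (n + 1))
    (N : Matrix (Fin (d v - m v)) (Fin (m v)) R) (A : Matrix p (Fin (d v)) R)
    (h : A * c.graphCols v N = 0) :
    A = A.submatrix id (c.split v ∘ Sum.inr) * c.graphEqns v N := by
  ext a x
  obtain ⟨x, rfl⟩ := (c.split v).surjective x
  have h1 := fun k => congrFun (congrFun h a) k
  simp only [Matrix.mul_apply, graphCols, graphEqns, Matrix.submatrix_apply,
    ← (c.split v).sum_comp, Fintype.sum_sum_type, Equiv.symm_apply_apply] at h1 ⊢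
  cases x with
  | inl k =>
    have := h1 k
    simp [Matrix.one_apply] at this ⊢
    linear_combination this
  | inr k => simp [Matrix.one_apply]

/-- The sequence of matrices with coordinates `x` in the chart: the `i`-th map factors as the
projection along the graph of `N i`, the map `W i` and the inclusion of the graph of
`N (i + 1)`. -/
def maps (x : ParamIdx d m → R) : MatSeq d R := fun i =>
  c.graphCols i.succ (paramN x i.succ) * paramW x i *
    c.graphEqns i.castSucc (paramN x i.castSucc)

/-- The minors of a sequence of matrices that are invertible on the chart. -/
def pivotMinor (M : MatSeq d R) (i : Fin n) : Matrix (Fin (m i.succ)) (Fin (m i.succ)) R :=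
  (M i).submatrix (c.split i.succ ∘ Sum.inl) (c.split i.castSucc ∘ Sum.inr ∘ c.pivot i)

/-- The product of the determinants of the minors that are invertible on the chart. -/
def pivotDet (M : MatSeq d R) : R := ∏ i, (c.pivotMinor M i).det

end Chart

theorem mul_mul_mul_eq_zero_of_middle {R : Type*} [CommRing R] {p₁ p₂ p₃ p₄ p₅ p₆ : Type*}
    [Fintype p₂] [Fintype p₃] [Fintype p₄] [Fintype p₅]
    (A : Matrix p₁ p₂ R) (B : Matrix p₂ p₃ R) (C : Matrix p₃ p₄ R) {p₇ : Type*} [Fintype p₇]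
    (D : Matrix p₄ p₇ R) (E : Matrix p₇ p₅ R) (F : Matrix p₅ p₆ R) (h : C * D = 0) :
    A * B * C * (D * E * F) = 0 := by
  rw [Matrix.mul_assoc D, Matrix.mul_assoc (A * B), ← Matrix.mul_assoc C, h]
  simp

theorem mul_submatrix_mul_eq_zero {R : Type*} [CommRing R] {p₁ p₂ p₃ p₄ p₅ : Type*}
    [Fintype p₂] [Fintype p₃] [Fintype p₄] (A : Matrix p₁ p₂ R) (B : Matrix p₂ p₃ R)
    (e : p₄ → p₃) (C : Matrix p₄ p₅ R) (h : A * B = 0) : A * (B.submatrix id e * C) = 0 := by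
  have h' := congrArg (fun X => Matrix.submatrix X id e) h
  simp only [Matrix.submatrix_mul _ _ _ id _ Function.bijective_id] at h'
  rw [← Matrix.mul_assoc, ← Matrix.submatrix_id_id A, h']
  simp

namespace Chart

variable {n : ℕ} {d : Fin (n + 1) → ℕ} {m : ℕ → ℕ} {R : Type*} [CommRing R] (c : Chart d m)

theorem isComplex_maps (x : ParamIdx d m → R) : (c.maps x).IsComplex := fun i hi =>
  mul_mul_mul_eq_zero_of_middle (R := R) _ _ _ _ _ _
    (c.graphEqns_mul_graphCols (Fin.castSucc ⟨i + 1, hi⟩) _)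

theorem graphCols_map {S : Type*} [CommRing S] (f : R →+* S) (v : Fin (n + 1))
    (N : Matrix (Fin (d v - m v)) (Fin (m v)) R) :
    (c.graphCols v N).map f = c.graphCols v (N.map f) := by
  ext a b
  obtain ⟨a, rfl⟩ := (c.split v).surjective a
  cases a <;> simp [graphCols, Matrix.one_apply, apply_ite f]

theorem graphEqns_map {S : Type*} [CommRing S] (f : R →+* S) (v : Fin (n + 1))
    (N : Matrix (Fin (d v - m v)) (Fin (m v)) R) :
    (c.graphEqns v N).map f = c.graphEqns v (N.map f) := by
  ext a b
  obtain ⟨b, rfl⟩ := (c.split v).surjective b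
  cases b <;> simp [graphEqns, Matrix.one_apply, apply_ite f]

theorem maps_map {S : Type*} [CommRing S] (f : R →+* S) (x : ParamIdx d m → R) (i : Fin n) :
    (c.maps x i).map f = c.maps (f ∘ x) i := by
  simp only [maps, Matrix.map_mul, graphCols_map, graphEqns_map]
  rfl

theorem pivotDet_map {S : Type*} [CommRing S] (f : R →+* S) (M : MatSeq d R) :
    f (c.pivotDet M) = c.pivotDet (fun i => (M i).map f) := by
  simp only [pivotDet, map_prod, RingHom.map_det]
  rfl

/-- The coordinates `W` are entries of the matrices of the sequence. -/
theorem maps_submatrix_inl_inr (x : ParamIdx d m → R) (i : Fin n) :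
    (c.maps x i).submatrix (c.split i.succ ∘ Sum.inl) (c.split i.castSucc ∘ Sum.inr) =
      paramW x i := by
  have h1 : (c.graphCols i.succ (paramN x i.succ)).submatrix (c.split i.succ ∘ Sum.inl) id = 1 := by
    ext a b
    simp [graphCols]
  have h2 : (c.graphEqns i.castSucc (paramN x i.castSucc)).submatrix id
      (c.split i.castSucc ∘ Sum.inr) = 1 := by
    ext a b
    simp [graphEqns]
  rw [maps, Matrix.submatrix_mul _ _ _ id _ Function.bijective_id,
    Matrix.submatrix_mul _ _ _ id _ Function.bijective_id, h1, h2]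
  simp

theorem pivotMinor_maps (x : ParamIdx d m → R) (i : Fin n) :
    c.pivotMinor (c.maps x) i = (paramW x i).submatrix id (c.pivot i) := by
  rw [← c.maps_submatrix_inl_inr x i]
  rfl

/-- The coordinates `N (i + 1)` are determined by the pivot columns of the `i`-th matrix. -/
theorem paramN_succ_mul_pivotMinor (x : ParamIdx d m → R) (i : Fin n) :
    paramN x i.succ * c.pivotMinor (c.maps x) i =
      (c.maps x i).submatrix (c.split i.succ ∘ Sum.inr)
        (c.split i.castSucc ∘ Sum.inr ∘ c.pivot i) := by
  have h1 : (c.graphCols i.succ (paramN x i.succ)).submatrix (c.split i.succ ∘ Sum.inr) id =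
      paramN x i.succ := by
    ext a b
    simp [graphCols]
  have h2 : (c.graphEqns i.castSucc (paramN x i.castSucc)).submatrix id
      (c.split i.castSucc ∘ Sum.inr ∘ c.pivot i) = Matrix.submatrix 1 id (c.pivot i) := by
    ext a b
    simp [graphEqns]
    rfl
  rw [pivotMinor_maps, maps, Matrix.submatrix_mul _ _ _ id _ Function.bijective_id,
    Matrix.submatrix_mul _ _ _ id _ Function.bijective_id, h1, h2, Matrix.mul_assoc]
  congr 1
  ext a b
  simp [Matrix.mul_apply, Matrix.one_apply]

section Field

variable {L : Type*} [Field L]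

theorem rank_maps (x : ParamIdx d m → L) (h : c.pivotDet (c.maps x) ≠ 0) (i : Fin n) :
    (c.maps x i).rank = m i.succ := by
  apply le_antisymm
  · rw [maps, Matrix.mul_assoc]
    refine (Matrix.rank_mul_le_left _ _).trans ((Matrix.rank_le_card_width _).trans ?_)
    simp
  · have := card_le_rank_of_det_submatrix_ne_zero (c.maps x i) _ _
      (Finset.prod_ne_zero_iff.1 h i (Finset.mem_univ i))
    simpa using this

/-- A complex with the prescribed ranks whose pivot minors are invertible lies on the chart. -/
theorem exists_maps_eq (hm : m 0 = 0) (M : MatSeq d L) (hM : M.IsComplex)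
    (hr : ∀ i, (M i).rank = m i.succ) (hdet : c.pivotDet M ≠ 0) :
    ∃ x : ParamIdx d m → L, c.maps x = M := by
  have hdet' : ∀ i, (c.pivotMinor M i).det ≠ 0 := fun i =>
    Finset.prod_ne_zero_iff.1 hdet i (Finset.mem_univ i)
  -- The spaces of boundaries are graphs; at the first vertex there are none.
  let N : ∀ v : Fin (n + 1), Matrix (Fin (d v - m v)) (Fin (m v)) L :=
    Fin.cases 0 fun i => (M i).submatrix (c.split i.succ ∘ Sum.inr)
      (c.split i.castSucc ∘ Sum.inr ∘ c.pivot i) * (c.pivotMinor M i)⁻¹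
  let x : ParamIdx d m → L := Sum.elim (fun p => N p.1 p.2.1 p.2.2)
    (fun p => M p.1 (c.split _ (Sum.inl p.2.1)) (c.split _ (Sum.inr p.2.2)))
  have hN : ∀ v, paramN x v = N v := fun v => rfl
  have hW : ∀ i, paramW x i = (M i).submatrix (c.split i.succ ∘ Sum.inl)
    (c.split i.castSucc ∘ Sum.inr) := fun i => rfl
  have hcols : ∀ i : Fin n, c.graphCols i.succ (N i.succ) =
      (M i).submatrix id (c.split i.castSucc ∘ Sum.inr ∘ c.pivot i) * (c.pivotMinor M i)⁻¹ := by
    intro i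
    ext a k
    obtain ⟨a, rfl⟩ := (c.split i.succ).surjective a
    cases a with
    | inl a =>
      have := congrFun (congrFun (Matrix.mul_nonsing_inv _ (hdet' i).isUnit) a) k
      simp only [graphCols, Matrix.submatrix_apply, Equiv.symm_apply_apply,
        Matrix.fromRows_apply_inl, id]
      rw [← this]
      rfl
    | inr a =>
      simp only [graphCols, Matrix.submatrix_apply, Equiv.symm_apply_apply,
        Matrix.fromRows_apply_inr, id]
      rfl
  have hfac : ∀ i : Fin n, M i = c.graphCols i.succ (N i.succ) *
      (M i).submatrix (c.split i.succ ∘ Sum.inl) id := by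
    intro i
    rw [hcols]
    exact eq_mul_inv_mul_of_rank_le (M i) _ _ (hdet' i) (by simp [hr])
  have hzero : ∀ i : Fin n, M i * c.graphCols i.castSucc (N i.castSucc) = 0 := by
    rintro ⟨i, hi⟩
    cases i with
    | zero =>
      ext a k
      exact absurd k.2 (by simp [hm])
    | succ i =>
      have h2 : c.graphCols (Fin.castSucc ⟨i + 1, hi⟩) (N (Fin.castSucc ⟨i + 1, hi⟩)) =
          (M.before i hi).submatrix id _ * _ := hcols ⟨i, Nat.lt_of_succ_lt hi⟩
      rw [h2]
      exact mul_submatrix_mul_eq_zero _ _ _ _ (hM i hi)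
  refine ⟨x, funext fun i => ?_⟩
  rw [maps, hN, hN, hW, Matrix.mul_assoc]
  conv_rhs => rw [hfac i]
  congr 1
  refine ((c.eq_mul_graphEqns i.castSucc (N i.castSucc)
    ((M i).submatrix (c.split i.succ ∘ Sum.inl) id) ?_)).symm
  have := congrArg (fun A => Matrix.submatrix A (c.split i.succ ∘ Sum.inl) id) (hzero i)
  rwa [Matrix.submatrix_mul _ _ _ id _ Function.bijective_id] at this

end Field

end Chart

/-! ### The charts cover the variety of complexes -/

/-- An injective family of `k` coordinates is the first part of a splitting of all coordinates. -/
theorem exists_equiv_sum_of_injective {k p : ℕ} (e : Fin k → Fin p) (he : Function.Injective e) :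
    ∃ s : Fin k ⊕ Fin (p - k) ≃ Fin p, ∀ x, s (Sum.inl x) = e x := by
  classical
  have hcard : Fintype.card {x // x ∉ Set.range e} = p - k := by
    rw [Fintype.card_subtype_compl, Fintype.card_fin]
    congr 1
    rw [Fintype.card_congr (Equiv.ofInjective e he).symm, Fintype.card_fin]
  refine ⟨(Equiv.sumCongr (Equiv.ofInjective e he)
    (Fintype.equivFinOfCardEq hcard).symm).trans (Equiv.sumCompl (· ∈ Set.range e)), fun x => ?_⟩
  simp

/-- Suppose that `A * B = 0`, that `A` has linearly independent rows, and that the rows of `B` in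
the first part of a splitting are linearly independent. Then the part of `A` consisting of the
columns in the second part of the splitting has linearly independent rows, because a linear
combination of rows of `A` that vanishes on the second part annihilates the rows of `B` in the first
part. -/
theorem linearIndependent_rows_submatrix_inr {L : Type*} [Field L] {p q s k l : Type*} [Fintype p]
    [Fintype q] [Fintype k] [Fintype l] (e : k ⊕ l ≃ q) (A : Matrix p q L) (B : Matrix q s L)
    (hA : LinearIndependent L A.row)
    (hB : LinearIndependent L (B.submatrix (e ∘ Sum.inl) id).row) (hAB : A * B = 0) :
    LinearIndependent L (A.submatrix id (e ∘ Sum.inr)).row := by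
  rw [Fintype.linearIndependent_iff] at hA hB ⊢
  intro x hx
  have hr : ∀ b : l, ∑ a, x a * A a (e (Sum.inr b)) = 0 := fun b => by
    simpa using congrFun hx b
  have hl : ∀ b : k, ∑ a, x a * A a (e (Sum.inl b)) = 0 := by
    refine hB _ (funext fun t => ?_)
    have h : ∑ z, (∑ a, x a * A a z) * B z t = 0 := by
      simp only [Finset.sum_mul, mul_assoc]
      rw [Finset.sum_comm]
      simp only [← Finset.mul_sum]
      have : ∀ a, ∑ z, A a z * B z t = 0 := fun a => congrFun (congrFun hAB a) t
      simp [this]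
    rw [← e.sum_comp, Fintype.sum_sum_type] at h
    simpa [hr] using h
  refine hA x (funext fun z => ?_)
  obtain ⟨z, rfl⟩ := e.surjective z
  cases z with
  | inl b => simpa using hl b
  | inr b => simpa using hr b

namespace Chart

variable {n : ℕ} {d : Fin (n + 1) → ℕ} {m : ℕ → ℕ}

/-- Every complex with the prescribed ranks over a field satisfies the nonvanishing condition of
some chart. -/
theorem exists_pivotDet_ne_zero {L : Type*} [Field L] (hm : m 0 = 0) (M : MatSeq d L)
    (hM : M.IsComplex) (hr : ∀ i, (M i).rank = m i.succ) :
    ∃ c : Chart d m, c.pivotDet M ≠ 0 := by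
  choose e he using fun i => exists_linearIndependent_rows (M i) (hr i)
  choose s hs using fun i => exists_equiv_sum_of_injective (e i) (Function.Injective.of_comp
    (f := (M i).row) (he i).injective)
  have h0 : Function.Injective (fun k : Fin (m (0 : Fin (n + 1))) =>
      (⟨0, absurd k.2 (by simp [hm])⟩ : Fin (d 0))) := by
    intro k
    exact absurd k.2 (by simp [hm])
  obtain ⟨s0, -⟩ := exists_equiv_sum_of_injective _ h0
  obtain ⟨split, hrow⟩ : ∃ split : ∀ v : Fin (n + 1), Fin (m v) ⊕ Fin (d v - m v) ≃ Fin (d v),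
      ∀ i : Fin n, LinearIndependent L
        ((M i).submatrix (split i.succ ∘ Sum.inl) id).row := by
    refine ⟨Fin.cases s0 s, fun i => ?_⟩
    have : (s i : Fin (m i.succ) ⊕ _ → Fin (d i.succ)) ∘ Sum.inl = e i := funext (hs i)
    simp only [Fin.cases_succ, this]
    exact he i
  have hW : ∀ i : Fin n, LinearIndependent L
      ((M i).submatrix (split i.succ ∘ Sum.inl) (split i.castSucc ∘ Sum.inr)).row := by
    rintro ⟨i, hi⟩
    cases i with
    | zero =>
      have : IsEmpty (Fin (m (Fin.castSucc (⟨0, hi⟩ : Fin n)))) := ⟨fun k =>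
        absurd k.2 (by simp [hm])⟩
      exact linearIndependent_rows_submatrix_inr (split (Fin.castSucc ⟨0, hi⟩))
        ((M ⟨0, hi⟩).submatrix (split (Fin.succ ⟨0, hi⟩) ∘ Sum.inl) id)
        (0 : Matrix _ (Fin 0) L) (hrow ⟨0, hi⟩) linearIndependent_empty_type (Matrix.mul_zero _)
    | succ i =>
      refine linearIndependent_rows_submatrix_inr (split (Fin.castSucc ⟨i + 1, hi⟩))
        ((M ⟨i + 1, hi⟩).submatrix (split (Fin.succ ⟨i + 1, hi⟩) ∘ Sum.inl) id)
        (M.before i hi) (hrow ⟨i + 1, hi⟩) (hrow ⟨i, Nat.lt_of_succ_lt hi⟩) ?_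
      have := congrArg (fun A => Matrix.submatrix A (split (Fin.succ ⟨i + 1, hi⟩) ∘ Sum.inl) id)
        (hM i hi)
      rwa [Matrix.submatrix_mul _ _ _ id _ Function.bijective_id] at this
  choose j hj using fun i => exists_det_submatrix_ne_zero _ (hW i)
  exact ⟨⟨split, j⟩, Finset.prod_ne_zero_iff.2 fun i _ => hj i⟩

/-- The chart around the standard complex, in which the `i`-th map takes the first `m (i + 1)` of
the basis vectors that are not boundaries to the basis vectors that are boundaries. -/
def standard (h : ∀ v : Fin (n + 1), m (v + 1) + m v ≤ d v) : Chart d m where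
  split v := finSumFinEquiv.trans (finCongr (by have := h v; omega))
  pivot i := Fin.castLE (by have := h i.castSucc; simp at this ⊢; omega)

/-- The coordinates of the standard complex in the standard chart. -/
def standardParam (K : Type*) [Field K] (d : Fin (n + 1) → ℕ) (m : ℕ → ℕ) : ParamIdx d m → K :=
  Sum.elim 0 fun p => if (p.2.1 : ℕ) = p.2.2 then 1 else 0

theorem pivotDet_standard (K : Type*) [Field K] (h : ∀ v : Fin (n + 1), m (v + 1) + m v ≤ d v) :
    (standard h).pivotDet ((standard h).maps (standardParam K d m)) ≠ 0 := by
  refine Finset.prod_ne_zero_iff.2 fun i _ => ?_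
  have : (standard h).pivotMinor ((standard h).maps (standardParam K d m)) i = 1 := by
    rw [pivotMinor_maps]
    ext a b
    simp [paramW, standardParam, standard, Matrix.one_apply, Fin.ext_iff]
  rw [this]
  simp

end Chart

/-! ### A parametrization of the variety of complexes by an affine space -/

/-- Index set of the entries of a square matrix of size `d v` for every vertex `v` and of a matrix
`W i` of size `m (i + 1) × (d i - m i)` for every arrow `i`. -/
abbrev FrameIdx {n : ℕ} (d : Fin (n + 1) → ℕ) (m : ℕ → ℕ) : Type :=
  (Σ v : Fin (n + 1), Fin (d v) × Fin (d v)) ⊕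
    (Σ i : Fin n, Fin (m i.succ) × Fin (d i.castSucc - m i.castSucc))

section Frame

variable {n : ℕ} {d : Fin (n + 1) → ℕ} {m : ℕ → ℕ} {R : Type*}

/-- The square matrices `g v` with entries given by `y`. -/
def frameG (y : FrameIdx d m → R) (v : Fin (n + 1)) : Matrix (Fin (d v)) (Fin (d v)) R :=
  Matrix.of fun a b => y (Sum.inl ⟨v, a, b⟩)

/-- The matrices `W i` with entries given by `y`. -/
def frameW (y : FrameIdx d m → R) (i : Fin n) :
    Matrix (Fin (m i.succ)) (Fin (d i.castSucc - m i.castSucc)) R :=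
  Matrix.of fun a b => y (Sum.inr ⟨i, a, b⟩)

namespace Chart

variable [CommRing R] (c : Chart d m)

/-- The complex obtained from arbitrary square matrices `g v` and arbitrary matrices `W i`. If the
`g v` are invertible, they are base changes that bring the spaces of boundaries in standard
position; the adjugate is used in place of the inverse, so that the formula is polynomial. -/
def frameMaps (y : FrameIdx d m → R) : MatSeq d R := fun i =>
  (frameG y i.succ).submatrix id (c.split i.succ ∘ Sum.inl) * frameW y i *
    (frameG y i.castSucc).adjugate.submatrix (c.split i.castSucc ∘ Sum.inr) id

theorem adjugate_submatrix_mul (g : ∀ v, Matrix (Fin (d v)) (Fin (d v)) R) (v : Fin (n + 1)) :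
    (g v).adjugate.submatrix (c.split v ∘ Sum.inr) id *
      (g v).submatrix id (c.split v ∘ Sum.inl) = 0 := by
  rw [← Matrix.submatrix_mul _ _ _ _ _ Function.bijective_id, Matrix.adjugate_mul]
  ext a b
  simp

theorem isComplex_frameMaps (y : FrameIdx d m → R) : (c.frameMaps y).IsComplex := fun i hi =>
  mul_mul_mul_eq_zero_of_middle (R := R) _ _ _ _ _ _
    (c.adjugate_submatrix_mul (frameG y) (Fin.castSucc ⟨i + 1, hi⟩))

theorem frameMaps_map {S : Type*} [CommRing S] (f : R →+* S) (y : FrameIdx d m → R) (i : Fin n) :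
    (c.frameMaps y i).map f = c.frameMaps (f ∘ y) i := by
  simp only [frameMaps, Matrix.map_mul]
  have : ∀ (e : Fin (d i.castSucc - m i.castSucc) → Fin (d i.castSucc)),
      ((frameG y i.castSucc).adjugate.submatrix e id).map f =
        (frameG (f ∘ y) i.castSucc).adjugate.submatrix e id := fun e =>
    congrArg (fun A => Matrix.submatrix A e id) (f.map_adjugate (frameG y i.castSucc))
  rw [this]
  rfl

theorem rank_frameMaps_le [Nontrivial R] (y : FrameIdx d m → R) (i : Fin n) :
    (c.frameMaps y i).rank ≤ m i.succ := by
  rw [frameMaps, Matrix.mul_assoc]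
  refine (Matrix.rank_mul_le_left _ _).trans ((Matrix.rank_le_card_width _).trans ?_)
  simp

/-- Every complex on a chart is obtained from frames: the boundaries, being a graph, are moved to
standard position by a unipotent matrix. -/
theorem exists_frameMaps_eq_maps {L : Type*} [Field L] (c' : Chart d m) (x : ParamIdx d m → L) :
    ∃ y : FrameIdx d m → L, c.frameMaps y = c'.maps x := by
  let g : ∀ v, Matrix (Fin (d v)) (Fin (d v)) L := fun v =>
    (Matrix.fromBlocks 1 0 (paramN x v) 1).submatrix (c'.split v).symm (c.split v).symm
  let g' : ∀ v, Matrix (Fin (d v)) (Fin (d v)) L := fun v =>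
    (Matrix.fromBlocks 1 0 (-paramN x v) 1).submatrix (c.split v).symm (c'.split v).symm
  have hg'g : ∀ v, g' v * g v = 1 := by
    intro v
    simp only [g, g', Matrix.submatrix_mul_equiv, Matrix.fromBlocks_multiply]
    simp
  have hgg' : ∀ v, g v * g' v = 1 := fun v => mul_eq_one_comm.1 (hg'g v)
  have hdet : ∀ v, (g v).det ≠ 0 := fun v h => by
    have := congrArg Matrix.det (hg'g v)
    simp [h] at this
  have hadj : ∀ v, (g v).adjugate = (g v).det • g' v := by
    intro v
    rw [← Matrix.mul_one (g v).adjugate, ← hgg' v, ← Matrix.mul_assoc, Matrix.adjugate_mul]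
    simp
  refine ⟨Sum.elim (fun p => g p.1 p.2.1 p.2.2)
    (fun p => (g p.1.castSucc).det⁻¹ * paramW x p.1 p.2.1 p.2.2), funext fun i => ?_⟩
  have h1 : (g i.succ).submatrix id (c.split i.succ ∘ Sum.inl) =
      c'.graphCols i.succ (paramN x i.succ) := by
    ext a b
    obtain ⟨a, rfl⟩ := (c'.split i.succ).surjective a
    cases a <;> simp [g, graphCols]
  have h2 : (g' i.castSucc).submatrix (c.split i.castSucc ∘ Sum.inr) id =
      c'.graphEqns i.castSucc (paramN x i.castSucc) := by
    ext a b
    obtain ⟨b, rfl⟩ := (c'.split i.castSucc).surjective b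
    cases b <;> simp [g', graphEqns]
  change (g i.succ).submatrix id (c.split i.succ ∘ Sum.inl) *
    ((g i.castSucc).det⁻¹ • paramW x i) *
      (g i.castSucc).adjugate.submatrix (c.split i.castSucc ∘ Sum.inr) id = _
  rw [hadj, h1]
  rw [show ((g i.castSucc).det • g' i.castSucc).submatrix (c.split i.castSucc ∘ Sum.inr) id =
    (g i.castSucc).det • (g' i.castSucc).submatrix (c.split i.castSucc ∘ Sum.inr) id from rfl]
  rw [h2, Matrix.mul_smul, Matrix.mul_smul, Matrix.smul_mul, smul_smul,
    mul_inv_cancel₀ (hdet _), one_smul, maps]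

end Chart

end Frame

/-! ### Points of the variety of complexes -/

section Points

variable {K : Type*} [Field K] {n : ℕ} {V : Fin (n + 1) → Type*}
  [∀ i, AddCommGroup (V i)] [∀ i, Module K (V i)] {d : Fin (n + 1) → ℕ}
  (b : ∀ i, Module.Basis (Fin (d i)) K (V i)) (r : Fin n → ℕ)

theorem extendRank_succ (i : Fin n) : extendRank r i.succ = r i := by
  simp [extendRank]

theorem MatSeq.isComplex_iff {R : Type*} [CommRing R] (M : MatSeq d R) : M.IsComplex ↔
    ∀ (i : ℕ) (hi : i + 1 < n) (a : Fin (d (Fin.succ ⟨i + 1, hi⟩)))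
      (c : Fin (d (Fin.castSucc ⟨i, Nat.lt_of_succ_lt hi⟩))),
      ∑ j : Fin (d (Fin.castSucc ⟨i + 1, hi⟩)), M ⟨i + 1, hi⟩ a j *
        M ⟨i, Nat.lt_of_succ_lt hi⟩ j c = 0 := by
  refine forall₂_congr fun i hi => ?_
  rw [← Matrix.ext_iff]
  rfl

theorem toLin_mem_rankStratum_iff (M : MatSeq d K) :
    (fun i => Matrix.toLin (b i.castSucc) (b i.succ) (M i) : MapSeq K V) ∈ rankStratum K V r ↔
      M.IsComplex ∧ ∀ i, (M i).rank = r i := by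
  refine and_congr ((toLin_mem_complexes_iff b M).trans M.isComplex_iff.symm)
    (forall_congr' fun i => ?_)
  rw [(M i).rank_eq_finrank_range_toLin (b i.succ) (b i.castSucc)]

theorem rank_pointMatrix_of_ker_eq {L : Type*} [Field L] (θ : CoordRing K d →+* L)
    (p : PrimeSpectrum (CoordRing K d)) (h : p.asIdeal = RingHom.ker θ) (i : Fin n) :
    (pointMatrix p i).rank = ((genericMatrix K d i).map θ).rank := by
  have hle : p.asIdeal.primeCompl ≤ (IsUnit.submonoid L).comap θ := by
    intro x hx
    have : θ x ≠ 0 := fun h0 => hx (h ▸ RingHom.mem_ker.2 h0)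
    exact this.isUnit
  let f : p.asIdeal.ResidueField →+* L := Ideal.ResidueField.lift p.asIdeal θ h.le hle
  have hf : (genericMatrix K d i).map θ = (pointMatrix p i).map f := by
    ext a c
    exact (Ideal.ResidueField.lift_algebraMap (I := p.asIdeal) θ h.le hle _).symm
  rw [hf, rank_map_of_field]

/-- Whether a point lies on the variety of complexes can be tested on the matrices over any field
that contains the residue field of the point. -/
theorem mem_stratumPoints_iff_of_ker_eq {L : Type*} [Field L] (θ : CoordRing K d →+* L)
    (p : PrimeSpectrum (CoordRing K d)) (h : p.asIdeal = RingHom.ker θ) :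
    p ∈ stratumPoints b r ↔
      MatSeq.IsComplex (fun i => (genericMatrix K d i).map θ : MatSeq d L) ∧
        ∀ i, ((genericMatrix K d i).map θ).rank = r i := by
  refine and_congr ?_ (forall_congr' fun i => ?_)
  · rw [pointMaps_mem_complexes_iff, MatSeq.isComplex_iff]
    refine forall₂_congr fun i hi => forall₂_congr fun a c => ?_
    rw [h, RingHom.mem_ker, map_sum]
    simp only [map_mul]
    rfl
  · rw [finrank_range_pointMaps, rank_pointMatrix_of_ker_eq θ p h]

theorem mem_stratumPoints_iff (p : PrimeSpectrum (CoordRing K d)) :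
    p ∈ stratumPoints b r ↔
      MatSeq.IsComplex (pointMatrix p : MatSeq d _) ∧ ∀ i, (pointMatrix p i).rank = r i :=
  mem_stratumPoints_iff_of_ker_eq b r (algebraMap _ p.asIdeal.ResidueField) p
    (Ideal.ker_algebraMap_residueField _).symm

/-- A family of sequences of matrices parametrized by an affine space passes through the point `p`
if it has the matrices of `p` as values over the residue field of `p`. -/
theorem exists_comap_aeval_eq {σ : Type*} (F : MatSeq d (MvPolynomial σ K))
    (p : PrimeSpectrum (CoordRing K d)) (y : σ → p.asIdeal.ResidueField)
    (h : ∀ i, (F i).map (MvPolynomial.aeval y) = pointMatrix p i) :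
    ∃ q : PrimeSpectrum (MvPolynomial σ K),
      PrimeSpectrum.comap ((MvPolynomial.aeval fun z => F z.1 z.2.1 z.2.2 :
        CoordRing K d →ₐ[K] MvPolynomial σ K) : CoordRing K d →+* MvPolynomial σ K) q = p := by
  let f : MvPolynomial σ K →ₐ[K] p.asIdeal.ResidueField := MvPolynomial.aeval y
  have hf : (f : MvPolynomial σ K →+* p.asIdeal.ResidueField).comp
      ((MvPolynomial.aeval fun z => F z.1 z.2.1 z.2.2 : CoordRing K d →ₐ[K] MvPolynomial σ K) :
        CoordRing K d →+* MvPolynomial σ K) = algebraMap _ _ := by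
    apply MvPolynomial.ringHom_ext
    · intro a
      simp [MvPolynomial.algebraMap_eq, f,
        IsScalarTower.algebraMap_apply K (CoordRing K d) p.asIdeal.ResidueField]
    · rintro ⟨i, a, e⟩
      refine Eq.trans ?_ (congrFun (congrFun (h i) a) e)
      simp [f]
  refine ⟨⟨RingHom.ker (f : MvPolynomial σ K →+* p.asIdeal.ResidueField),
    RingHom.ker_isPrime _⟩, ?_⟩
  ext1
  rw [PrimeSpectrum.comap_asIdeal, RingHom.comap_ker, hf, Ideal.ker_algebraMap_residueField]

end Points

/-! ### Charts as morphisms of affine varieties -/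

namespace Chart

/-- A polynomial expression in the entries of a sequence of matrices, which on the chart is the
coordinate matrix `N (i + 1)` multiplied by the determinant of the pivot minor. -/
def cramerMatrix {n : ℕ} {d : Fin (n + 1) → ℕ} {m : ℕ → ℕ} (c : Chart d m) {R : Type*}
    [CommRing R] (M : MatSeq d R) (i : Fin n) :
    Matrix (Fin (d i.succ - m i.succ)) (Fin (m i.succ)) R :=
  (M i).submatrix (c.split i.succ ∘ Sum.inr) (c.split i.castSucc ∘ Sum.inr ∘ c.pivot i) *
    (c.pivotMinor M i).adjugate

section Cramer

variable {n : ℕ} {d : Fin (n + 1) → ℕ} {m : ℕ → ℕ} (c : Chart d m) {R : Type*} [CommRing R]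

theorem cramerMatrix_map {S : Type*} [CommRing S] (f : R →+* S) (M : MatSeq d R) (i : Fin n) :
    (c.cramerMatrix M i).map f = c.cramerMatrix (fun i => (M i).map f) i := by
  rw [cramerMatrix, Matrix.map_mul, cramerMatrix]
  congr 1
  exact f.map_adjugate _

theorem cramerMatrix_maps (x : ParamIdx d m → R) (i : Fin n) :
    c.cramerMatrix (c.maps x) i = (c.pivotMinor (c.maps x) i).det • paramN x i.succ := by
  rw [cramerMatrix, ← paramN_succ_mul_pivotMinor, Matrix.mul_assoc, Matrix.mul_adjugate,
    Matrix.mul_smul, Matrix.mul_one]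

end Cramer

variable {K : Type*} [Field K] {n : ℕ} {V : Fin (n + 1) → Type*}
  [∀ i, AddCommGroup (V i)] [∀ i, Module K (V i)] {d : Fin (n + 1) → ℕ} {m : ℕ → ℕ}
  (b : ∀ i, Module.Basis (Fin (d i)) K (V i)) {r : Fin n → ℕ}

variable (K) in
/-- The homomorphism of coordinate rings for the map `Chart.maps` from the affine space of chart
coordinates to the affine space of sequences of matrices. -/
def coordHom (c : Chart d m) : CoordRing K d →ₐ[K] MvPolynomial (ParamIdx d m) K :=
  MvPolynomial.aeval fun z => c.maps MvPolynomial.X z.1 z.2.1 z.2.2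

variable (K) in
/-- The function on the affine space of sequences of matrices whose nonvanishing defines the
chart. -/
def pivotElt (c : Chart d m) : CoordRing K d := c.pivotDet (genericMatrix K d)

theorem genericMatrix_map_coordHom (c : Chart d m) (i : Fin n) :
    (genericMatrix K d i).map (c.coordHom K) = c.maps MvPolynomial.X i := by
  ext a e
  simp [genericMatrix, coordHom]

theorem genericMatrix_map_comp_coordHom (c : Chart d m) {L : Type*} [CommRing L]
    (f : MvPolynomial (ParamIdx d m) K →+* L) (i : Fin n) :
    (genericMatrix K d i).map (f.comp (c.coordHom K : CoordRing K d →+* _)) =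
      c.maps (f ∘ MvPolynomial.X) i := by
  rw [← maps_map, ← genericMatrix_map_coordHom]
  rfl

theorem comp_coordHom_pivotElt (c : Chart d m) {L : Type*} [CommRing L]
    (f : MvPolynomial (ParamIdx d m) K →+* L) :
    f (c.coordHom K (c.pivotElt K)) = c.pivotDet (c.maps (f ∘ MvPolynomial.X)) := by
  change (f.comp (c.coordHom K : CoordRing K d →+* _)) (c.pivotElt K) = _
  rw [pivotElt, pivotDet_map]
  congr 1
  exact funext fun i => genericMatrix_map_comp_coordHom c f i

theorem comap_coordHom_mem_stratumPoints (c : Chart d (extendRank r))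
    (q : PrimeSpectrum (MvPolynomial (ParamIdx d (extendRank r)) K))
    (hq : c.coordHom K (c.pivotElt K) ∉ q.asIdeal) :
    PrimeSpectrum.comap (c.coordHom K : CoordRing K d →+* _) q ∈ stratumPoints b r := by
  let f := algebraMap (MvPolynomial (ParamIdx d (extendRank r)) K) q.asIdeal.ResidueField
  rw [mem_stratumPoints_iff_of_ker_eq b r (f.comp (c.coordHom K : CoordRing K d →+* _))]
  · simp only [genericMatrix_map_comp_coordHom]
    refine ⟨c.isComplex_maps _, fun i => ?_⟩
    rw [c.rank_maps, extendRank_succ]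
    rw [← comp_coordHom_pivotElt]
    rwa [Ne, Ideal.algebraMap_residueField_eq_zero]
  · rw [← RingHom.comap_ker, Ideal.ker_algebraMap_residueField]
    rfl

theorem exists_comap_coordHom_eq (c : Chart d (extendRank r))
    (p : PrimeSpectrum (CoordRing K d)) (hp : p ∈ stratumPoints b r)
    (hc : c.pivotElt K ∉ p.asIdeal) :
    ∃ q : PrimeSpectrum (MvPolynomial (ParamIdx d (extendRank r)) K),
      PrimeSpectrum.comap (c.coordHom K : CoordRing K d →+* _) q = p := by
  rw [mem_stratumPoints_iff] at hp
  obtain ⟨x, hx⟩ := c.exists_maps_eq rfl (pointMatrix p) hp.1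
    (fun i => by rw [hp.2, extendRank_succ]) (by
      rw [← Ideal.algebraMap_residueField_eq_zero, pivotElt, pivotDet_map] at hc
      exact hc)
  refine exists_comap_aeval_eq (c.maps MvPolynomial.X) p x fun i => ?_
  rw [← hx]
  refine (c.maps_map (MvPolynomial.aeval x : MvPolynomial (ParamIdx d (extendRank r)) K →ₐ[K]
    p.asIdeal.ResidueField).toRingHom MvPolynomial.X i).trans ?_
  congr 1
  exact funext fun z => MvPolynomial.aeval_X _ _

theorem coordHom_eq_zero_of_mem_stratumIdeal (c : Chart d (extendRank r))
    (hc : c.coordHom K (c.pivotElt K) ≠ 0) {x : CoordRing K d} (hx : x ∈ stratumIdeal b r) :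
    c.coordHom K x = 0 := by
  have h := c.comap_coordHom_mem_stratumPoints b ⟨⊥, Ideal.isPrime_bot⟩ (by simpa using hc)
  have := (PrimeSpectrum.mem_vanishingIdeal _ _).1 hx _ h
  simpa [PrimeSpectrum.comap_asIdeal] using this

theorem pivotElt_mul_mem_stratumIdeal (c : Chart d (extendRank r))
    {x : CoordRing K d} (hx : c.coordHom K x = 0) : c.pivotElt K * x ∈ stratumIdeal b r := by
  refine (PrimeSpectrum.mem_vanishingIdeal _ _).2 fun p hp => ?_
  by_cases hc : c.pivotElt K ∈ p.asIdeal
  · exact Ideal.mul_mem_right _ _ hc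
  · obtain ⟨q, rfl⟩ := c.exists_comap_coordHom_eq b p hp hc
    refine Ideal.mul_mem_left _ _ ?_
    simp [PrimeSpectrum.comap_asIdeal, hx]

/-- Chart coordinates are quotients of matrix entries by powers of the pivot determinant. -/
theorem exists_pow_mul_eq_coordHom (c : Chart d m) (hm : m 0 = 0)
    (y : MvPolynomial (ParamIdx d m) K) :
    ∃ (k : ℕ) (x : CoordRing K d), y * c.coordHom K (c.pivotElt K) ^ k = c.coordHom K x := by
  induction y using MvPolynomial.induction_on with
  | C a => exact ⟨0, MvPolynomial.C a, by simp [coordHom, MvPolynomial.algebraMap_eq]⟩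
  | add y₁ y₂ h₁ h₂ =>
    obtain ⟨k₁, x₁, h₁⟩ := h₁
    obtain ⟨k₂, x₂, h₂⟩ := h₂
    refine ⟨k₁ + k₂, x₁ * c.pivotElt K ^ k₂ + x₂ * c.pivotElt K ^ k₁, ?_⟩
    simp only [map_add, map_mul, map_pow, ← h₁, ← h₂]
    ring
  | mul_X y z h =>
    obtain ⟨k, x, h⟩ := h
    suffices h' : ∃ (l : ℕ) (t : CoordRing K d),
        MvPolynomial.X z * c.coordHom K (c.pivotElt K) ^ l = c.coordHom K t by
      obtain ⟨l, t, h'⟩ := h'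
      refine ⟨k + l, x * t, ?_⟩
      rw [map_mul, ← h, ← h']
      ring
    rcases z with ⟨v, a, e⟩ | ⟨i, a, e⟩
    · cases v using Fin.cases with
      | zero => exact absurd e.2 (by simp [hm])
      | succ i =>
        -- By Cramer's rule, `N (i + 1)` times the `i`-th pivot determinant is polynomial.
        let φ : CoordRing K d →+* MvPolynomial (ParamIdx d m) K := c.coordHom K
        have hgen : (fun i => (genericMatrix K d i).map φ) = c.maps MvPolynomial.X :=
          funext fun i => genericMatrix_map_coordHom c i
        refine ⟨1, c.cramerMatrix (genericMatrix K d) i a e * ∏ j ∈ Finset.univ.erase i,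
          (c.pivotMinor (genericMatrix K d) j).det, ?_⟩
        have h1 := congrFun (congrFun (c.cramerMatrix_map φ (genericMatrix K d) i) a) e
        rw [hgen, c.cramerMatrix_maps] at h1
        have h2 : φ (c.pivotMinor (genericMatrix K d) i).det =
            (c.pivotMinor (c.maps (MvPolynomial.X :
              _ → MvPolynomial (ParamIdx d m) K)) i).det := by
          rw [← hgen]
          exact φ.map_det _
        change MvPolynomial.X _ * φ _ ^ 1 = φ _
        rw [pow_one, pivotElt, pivotDet, ← Finset.mul_prod_erase _ _ (Finset.mem_univ i), map_mul,
          map_mul, ← mul_assoc, h2]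
        congr 1
        refine Eq.trans ?_ h1.symm
        exact mul_comm _ _
    · refine ⟨0, MvPolynomial.X ⟨i, c.split _ (Sum.inl a), c.split _ (Sum.inr e)⟩, ?_⟩
      have h1 := congrFun (congrFun (c.maps_submatrix_inl_inr
        (MvPolynomial.X : _ → MvPolynomial (ParamIdx d m) K) i) a) e
      simp only [pow_zero, mul_one, coordHom, MvPolynomial.aeval_X]
      exact h1.symm

/-- The coordinate ring of a chart: polynomials in the chart coordinates with the pivot determinant
inverted. -/
abbrev AwayRing (K : Type*) [Field K] (c : Chart d m) : Type _ :=
  Localization.Away (c.coordHom K (c.pivotElt K))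

/-- The homomorphism of coordinate rings for the inclusion of the chart in the closure of the
variety of complexes. -/
def awayHom (c : Chart d (extendRank r)) (hc : c.coordHom K (c.pivotElt K) ≠ 0) :
    (CoordRing K d ⧸ stratumIdeal b r) →ₐ[K] c.AwayRing K :=
  Ideal.Quotient.liftₐ _ ((IsScalarTower.toAlgHom K (MvPolynomial (ParamIdx d (extendRank r)) K)
    (c.AwayRing K)).comp (c.coordHom K)) fun x hx => by
      simp [c.coordHom_eq_zero_of_mem_stratumIdeal b hc hx]

/-- The chart is the open subset of the closure of the variety of complexes where the pivot
determinant does not vanish, with its reduced structure. -/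
theorem isLocalization_awayHom (c : Chart d (extendRank r))
    (hc : c.coordHom K (c.pivotElt K) ≠ 0) :
    letI := (c.awayHom b hc).toRingHom.toAlgebra
    IsLocalization.Away (Ideal.Quotient.mk (stratumIdeal b r) (c.pivotElt K)) (c.AwayRing K) := by
  let := (c.awayHom b hc).toRingHom.toAlgebra
  have halg : ∀ x : CoordRing K d, algebraMap (CoordRing K d ⧸ stratumIdeal b r) (c.AwayRing K)
      (Ideal.Quotient.mk _ x) = algebraMap _ (c.AwayRing K) (c.coordHom K x) := fun x => rfl
  have hu : IsUnit (algebraMap (MvPolynomial (ParamIdx d (extendRank r)) K) (c.AwayRing K)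
      (c.coordHom K (c.pivotElt K))) := IsLocalization.Away.algebraMap_isUnit _
  refine IsLocalization.Away.mk _ ?_ ?_ ?_
  · rw [halg]
    exact hu
  · intro s
    obtain ⟨k, y, hy⟩ := IsLocalization.Away.surj (c.coordHom K (c.pivotElt K)) s
    obtain ⟨l, x, hx⟩ := c.exists_pow_mul_eq_coordHom rfl y
    refine ⟨k + l, Ideal.Quotient.mk _ x, ?_⟩
    rw [halg, halg, ← hx, pow_add, ← mul_assoc, hy, map_mul, map_pow]
  · intro x y hxy
    obtain ⟨x, rfl⟩ := Ideal.Quotient.mk_surjective x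
    obtain ⟨y, rfl⟩ := Ideal.Quotient.mk_surjective y
    rw [halg, halg] at hxy
    have hinj : Function.Injective (algebraMap (MvPolynomial (ParamIdx d (extendRank r)) K)
        (c.AwayRing K)) := IsLocalization.injective _ (powers_le_nonZeroDivisors_of_noZeroDivisors hc)
    have h0 : c.coordHom K (x - y) = 0 := by rw [map_sub, hinj hxy, sub_self]
    refine ⟨1, ?_⟩
    have := Ideal.Quotient.eq_zero_iff_mem.2 (c.pivotElt_mul_mem_stratumIdeal b h0)
    rw [map_mul, map_sub, mul_sub, sub_eq_zero] at this
    rwa [pow_one]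

end Chart

/-! ### Charts as open subschemes; smoothness -/

section OpenCharts

universe u v

open AlgebraicGeometry CategoryTheory

variable {K : Type u} [Field K] {n : ℕ} {V : Fin (n + 1) → Type v}
  [∀ i, AddCommGroup (V i)] [∀ i, Module K (V i)] {d : Fin (n + 1) → ℕ}
  (b : ∀ i, Module.Basis (Fin (d i)) K (V i)) {r : Fin n → ℕ}

variable (r) in
/-- The inclusion of the variety of complexes in its closure. -/
def stratumι : stratum b r ⟶ Spec (CommRingCat.of (CoordRing K d ⧸ stratumIdeal b r)) :=
  (stratumOpens b r).ι

instance isOpenImmersion_stratumι : IsOpenImmersion (stratumι b r) :=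
  inferInstanceAs (IsOpenImmersion (stratumOpens b r).ι)

theorem range_stratumι : Set.range (stratumι b r) =
    PrimeSpectrum.comap (Ideal.Quotient.mk (stratumIdeal b r)) ⁻¹' stratumPoints b r :=
  Scheme.Opens.range_ι (stratumOpens b r)

namespace Chart

variable (c : Chart d (extendRank r)) (hc : c.coordHom K (c.pivotElt K) ≠ 0)

/-- The inclusion of a chart in the closure of the variety of complexes. -/
def toClosure : Spec (CommRingCat.of (c.AwayRing K)) ⟶
    Spec (CommRingCat.of (CoordRing K d ⧸ stratumIdeal b r)) :=
  Spec.map (CommRingCat.ofHom (c.awayHom b hc).toRingHom)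

instance isOpenImmersion_toClosure : IsOpenImmersion (c.toClosure b hc) := by
  let := (c.awayHom b hc).toRingHom.toAlgebra
  have := c.isLocalization_awayHom b hc
  exact IsOpenImmersion.of_isLocalization (Ideal.Quotient.mk (stratumIdeal b r) (c.pivotElt K))

theorem range_toClosure : Set.range (c.toClosure b hc) =
    (PrimeSpectrum.basicOpen (Ideal.Quotient.mk (stratumIdeal b r) (c.pivotElt K)) :
      Set (PrimeSpectrum (CoordRing K d ⧸ stratumIdeal b r))) := by
  let := (c.awayHom b hc).toRingHom.toAlgebra
  have := c.isLocalization_awayHom b hc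
  exact PrimeSpectrum.localization_away_comap_range _ _

theorem range_toClosure_subset : Set.range (c.toClosure b hc) ⊆ Set.range (stratumι b r) := by
  rintro _ ⟨q, rfl⟩
  rw [range_stratumι]
  let q' : PrimeSpectrum (MvPolynomial (ParamIdx d (extendRank r)) K) :=
    PrimeSpectrum.comap (algebraMap _ (c.AwayRing K)) q
  have hq' : c.coordHom K (c.pivotElt K) ∉ q'.asIdeal := by
    intro h
    exact q.2.ne_top (Ideal.eq_top_of_isUnit_mem _ h
      (IsLocalization.Away.algebraMap_isUnit (c.coordHom K (c.pivotElt K))))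
  exact c.comap_coordHom_mem_stratumPoints b q' hq'

/-- The inclusion of a chart in the variety of complexes. -/
def toStratum : Spec (CommRingCat.of (c.AwayRing K)) ⟶ stratum b r :=
  IsOpenImmersion.lift (stratumι b r) (c.toClosure b hc) (c.range_toClosure_subset b hc)

theorem toStratum_ι : c.toStratum b hc ≫ stratumι b r = c.toClosure b hc :=
  IsOpenImmersion.lift_fac _ _ _

instance isOpenImmersion_toStratum : IsOpenImmersion (c.toStratum b hc) := by
  have : IsOpenImmersion (c.toStratum b hc ≫ stratumι b r) := by
    rw [toStratum_ι]
    infer_instance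
  exact IsOpenImmersion.of_comp _ (stratumι b r)

theorem toStratum_stratumToSpec : c.toStratum b hc ≫ stratumToSpec b r =
    Spec.map (CommRingCat.ofHom (algebraMap K (c.AwayRing K))) := by
  change c.toStratum b hc ≫ stratumι b r ≫ _ = _
  rw [← Category.assoc, toStratum_ι, toClosure, ← Spec.map_comp,
    ← CommRingCat.ofHom_comp]
  congr 2
  exact (c.awayHom b hc).comp_algebraMap

theorem smooth_algebraMap_awayRing : (algebraMap K (c.AwayRing K)).Smooth := by
  rw [RingHom.smooth_algebraMap]
  have : Algebra.Smooth K (MvPolynomial (ParamIdx d (extendRank r)) K) :=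
    ⟨inferInstance, inferInstance⟩
  have : Algebra.Smooth (MvPolynomial (ParamIdx d (extendRank r)) K) (c.AwayRing K) :=
    Algebra.Smooth.of_isLocalization_Away (c.coordHom K (c.pivotElt K))
  exact Algebra.Smooth.comp K (MvPolynomial (ParamIdx d (extendRank r)) K) (c.AwayRing K)

end Chart

theorem exists_toStratum_eq (x : stratum b r) :
    ∃ (c : Chart d (extendRank r)) (hc : c.coordHom K (c.pivotElt K) ≠ 0)
      (y : Spec (CommRingCat.of (c.AwayRing K))), c.toStratum b hc y = x := by
  let q : PrimeSpectrum (CoordRing K d ⧸ stratumIdeal b r) := stratumι b r x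
  let p := PrimeSpectrum.comap (Ideal.Quotient.mk (stratumIdeal b r)) q
  have hp : p ∈ stratumPoints b r := x.2
  have hp' := (mem_stratumPoints_iff b r p).1 hp
  obtain ⟨c, hpiv⟩ := Chart.exists_pivotDet_ne_zero (m := extendRank r) rfl _ hp'.1
    (fun i => by rw [hp'.2, extendRank_succ])
  have hcp : c.pivotElt K ∉ p.asIdeal := by
    rw [← Ideal.algebraMap_residueField_eq_zero, Chart.pivotElt, Chart.pivotDet_map]
    exact hpiv
  have hc : c.coordHom K (c.pivotElt K) ≠ 0 := by
    obtain ⟨z, hz⟩ := c.exists_comap_coordHom_eq b p hp hcp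
    intro h0
    apply hcp
    rw [← hz, PrimeSpectrum.comap_asIdeal, Ideal.mem_comap]
    change c.coordHom K (c.pivotElt K) ∈ z.asIdeal
    rw [h0]
    exact zero_mem _
  have hq : q ∈ Set.range (c.toClosure b hc) := by
    rw [Chart.range_toClosure]
    exact hcp
  obtain ⟨y, hy⟩ := hq
  refine ⟨c, hc, y, (stratumι b r).isOpenEmbedding.injective ?_⟩
  rw [← Scheme.Hom.comp_apply, Chart.toStratum_ι]
  exact hy

/-- The variety of complexes is smooth, since its charts are open in affine spaces. -/
theorem smooth_stratumToSpec : Smooth (stratumToSpec b r) := by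
  let 𝒰 : (stratum b r).OpenCover := Scheme.Cover.mkOfCovers
    {c : Chart d (extendRank r) // c.coordHom K (c.pivotElt K) ≠ 0}
    (fun c => Spec (CommRingCat.of (c.1.AwayRing K))) (fun c => c.1.toStratum b c.2)
    (fun x => by
      obtain ⟨c, hc, y, hy⟩ := exists_toStratum_eq b x
      exact ⟨⟨c, hc⟩, y, hy⟩) (fun c => c.1.isOpenImmersion_toStratum b c.2)
  have : IsZariskiLocalAtSource @Smooth.{u} :=
    HasRingHomProperty.instIsZariskiLocalAtSource (Q := RingHom.Smooth)
  refine IsZariskiLocalAtSource.of_openCover 𝒰 fun c => ?_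
  have h : 𝒰.f c ≫ stratumToSpec b r =
      Spec.map (CommRingCat.ofHom (algebraMap K (c.1.AwayRing K))) :=
    c.1.toStratum_stratumToSpec b c.2
  rw [h]
  exact (HasRingHomProperty.Spec_iff (P := @Smooth)).2 c.1.smooth_algebraMap_awayRing

end OpenCharts

/-! ### Irreducibility -/

section Irreducible

variable {K : Type*} [Field K] {n : ℕ} {V : Fin (n + 1) → Type*}
  [∀ i, AddCommGroup (V i)] [∀ i, Module K (V i)] {d : Fin (n + 1) → ℕ} {m : ℕ → ℕ}
  (b : ∀ i, Module.Basis (Fin (d i)) K (V i)) {r : Fin n → ℕ}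

variable (K) in
/-- The homomorphism of coordinate rings for the map `Chart.frameMaps`. -/
def Chart.frameHom (c : Chart d m) : CoordRing K d →ₐ[K] MvPolynomial (FrameIdx d m) K :=
  MvPolynomial.aeval fun z => c.frameMaps MvPolynomial.X z.1 z.2.1 z.2.2

theorem Chart.genericMatrix_map_comp_frameHom (c : Chart d m) {L : Type*} [CommRing L]
    (f : MvPolynomial (FrameIdx d m) K →+* L) (i : Fin n) :
    (genericMatrix K d i).map (f.comp (c.frameHom K : CoordRing K d →+* _)) =
      c.frameMaps (f ∘ MvPolynomial.X) i := by
  rw [← Chart.frameMaps_map]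
  ext a e
  simp [genericMatrix, Chart.frameHom]

/-- The variety of complexes consists of the points of maximal ranks in the image of an affine
space. -/
theorem stratumPoints_eq_range_inter (c : Chart d (extendRank r)) : stratumPoints b r =
    Set.range (PrimeSpectrum.comap (c.frameHom K : CoordRing K d →+*
      MvPolynomial (FrameIdx d (extendRank r)) K)) ∩
      ⋂ i, {p | r i ≤ (pointMatrix p i).rank} := by
  ext p
  constructor
  · intro hp
    rw [mem_stratumPoints_iff] at hp
    have hr : ∀ i : Fin n, (pointMatrix p i).rank = extendRank r i.succ := fun i => by
      rw [hp.2, extendRank_succ]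
    refine ⟨?_, Set.mem_iInter.2 fun i => (hp.2 i).ge⟩
    obtain ⟨c', hc'⟩ := Chart.exists_pivotDet_ne_zero rfl _ hp.1 hr
    obtain ⟨x, hx⟩ := c'.exists_maps_eq rfl _ hp.1 hr hc'
    obtain ⟨y, hy⟩ := c.exists_frameMaps_eq_maps c' x
    refine exists_comap_aeval_eq (c.frameMaps MvPolynomial.X) p y fun i => ?_
    rw [← hx, ← hy]
    refine (c.frameMaps_map (MvPolynomial.aeval y : MvPolynomial (FrameIdx d (extendRank r)) K
      →ₐ[K] p.asIdeal.ResidueField).toRingHom MvPolynomial.X i).trans ?_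
    congr 1
    exact funext fun z => MvPolynomial.aeval_X _ _
  · rintro ⟨⟨q, rfl⟩, hp⟩
    rw [Set.mem_iInter] at hp
    let f := algebraMap (MvPolynomial (FrameIdx d (extendRank r)) K) q.asIdeal.ResidueField
    have hker : (PrimeSpectrum.comap (c.frameHom K : CoordRing K d →+* _) q).asIdeal =
        RingHom.ker (f.comp (c.frameHom K : CoordRing K d →+* _)) := by
      rw [← RingHom.comap_ker, Ideal.ker_algebraMap_residueField]
      rfl
    rw [mem_stratumPoints_iff_of_ker_eq b r _ _ hker]
    refine ⟨?_, fun i => le_antisymm ?_ ?_⟩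
    · simp only [Chart.genericMatrix_map_comp_frameHom]
      exact c.isComplex_frameMaps _
    · rw [Chart.genericMatrix_map_comp_frameHom]
      exact (c.rank_frameMaps_le _ i).trans (extendRank_succ r i).le
    · rw [← rank_pointMatrix_of_ker_eq _ _ hker]
      exact hp i

theorem isPreirreducible_stratumPoints (c : Chart d (extendRank r)) :
    IsPreirreducible (stratumPoints b r) := by
  rw [stratumPoints_eq_range_inter b c]
  have hT : IsPreirreducible
      (Set.range (PrimeSpectrum.comap (c.frameHom K : CoordRing K d →+*
      MvPolynomial (FrameIdx d (extendRank r)) K))) := by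
    rw [← Set.image_univ]
    exact (PreirreducibleSpace.isPreirreducible_univ).image _
      (PrimeSpectrum.continuous_comap _).continuousOn
  have hU : IsOpen (⋂ i, {p : PrimeSpectrum (CoordRing K d) | r i ≤ (pointMatrix p i).rank}) :=
    isOpen_iInter_of_finite fun i => isOpen_le_rank i _
  intro u v hu hv ⟨x, hx, hxu⟩ ⟨y, hy, hyv⟩
  obtain ⟨z, hz, hzu, hzv⟩ := hT _ _ (hU.inter hu) (hU.inter hv) ⟨x, hx.1, hx.2, hxu⟩
    ⟨y, hy.1, hy.2, hyv⟩
  exact ⟨z, ⟨hz, hzu.1⟩, hzu.2, hzv.2⟩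

open AlgebraicGeometry in
theorem irreducibleSpace_stratum (c : Chart d (extendRank r)) (hne : (stratumPoints b r).Nonempty)
    [Nonempty (stratum b r)] : IrreducibleSpace (stratum b r) := by
  have hprime : (stratumIdeal b r).IsPrime :=
    PrimeSpectrum.isIrreducible_iff_vanishingIdeal_isPrime.1
      ⟨hne, isPreirreducible_stratumPoints b c⟩
  have : IsDomain (CommRingCat.of (CoordRing K d ⧸ stratumIdeal b r)) :=
    Ideal.Quotient.isDomain (stratumIdeal b r)
  have : IsIntegral (stratum b r) := isIntegral_of_isOpenImmersion (stratumι b r)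
  infer_instance

end Irreducible

/-! ### Dimension -/

section Dimension

/-- The dimension of a space is bounded by the dimensions of the members of an open cover. -/
theorem topologicalKrullDim_le_of_forall_exists_isOpenEmbedding {X : Type*} [TopologicalSpace X]
    (N : WithBot ℕ∞) (h : ∀ x : X, ∃ (Y : Type*) (_ : TopologicalSpace Y) (f : Y → X),
      Topology.IsOpenEmbedding f ∧ x ∈ Set.range f ∧ topologicalKrullDim Y ≤ N) :
    topologicalKrullDim X ≤ N := by
  rw [topologicalKrullDim, Order.krullDim_eq_iSup_coheight]
  refine iSup_le fun Z => ?_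
  obtain ⟨x, hx⟩ := Z.2.nonempty
  obtain ⟨Y, _, f, hf, ⟨y, rfl⟩, hN⟩ := h x
  let e := TopologicalSpace.IrreducibleCloseds.orderIsoOfIsOpenEmbedding f hf
  have hZ : TopologicalSpace.IrreducibleCloseds.map f hf.continuous (e.symm ⟨Z, ⟨y, hx⟩⟩) = Z :=
    congrArg Subtype.val (e.apply_symm_apply ⟨Z, ⟨y, hx⟩⟩)
  rw [← hZ, hf.coheight_map]
  exact (Order.coheight_le_krullDim _).trans hN

variable {K : Type*} [Field K]

theorem ringKrullDim_away_le {σ : Type*} [Finite σ] (g : MvPolynomial σ K) :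
    ringKrullDim (Localization.Away g) ≤ Nat.card σ := by
  have h : ringKrullDim (MvPolynomial σ K) = Nat.card σ := by
    simp [MvPolynomial.ringKrullDim_of_isNoetherianRing]
  rw [← h, ← PrimeSpectrum.topologicalKrullDim_eq_ringKrullDim,
    ← PrimeSpectrum.topologicalKrullDim_eq_ringKrullDim]
  exact (PrimeSpectrum.localization_away_isOpenEmbedding
    (Localization.Away g) g).isInducing.topologicalKrullDim_le

/-- The chain of linear subspaces through the rational point `a` spanned by coordinate directions
shows that an open neighbourhood of `a` has at least the dimension of the affine space. -/
theorem le_ringKrullDim_away {N : ℕ} (g : MvPolynomial (Fin N) K) (a : Fin N → K)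
    (ha : MvPolynomial.eval a g ≠ 0) : (N : WithBot ℕ∞) ≤ ringKrullDim (Localization.Away g) := by
  let s : ℕ → MvPolynomial (Fin N) K →ₐ[K] MvPolynomial (Fin N) K := fun k =>
    MvPolynomial.aeval fun i => if (i : ℕ) < k then MvPolynomial.C (a i) else MvPolynomial.X i
  have hs : ∀ k y, s (k + 1) (s k y) = s (k + 1) y := by
    intro k y
    rw [← AlgHom.comp_apply]
    congr 1
    refine MvPolynomial.algHom_ext fun i => ?_
    by_cases hi : (i : ℕ) < k
    · simp [s, hi, hi.le, ← MvPolynomial.algebraMap_eq]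
    · simp [s, hi]
  have heval : ∀ k, MvPolynomial.eval a (s k g) ≠ 0 := by
    intro k
    convert ha using 1
    change (MvPolynomial.aeval a : MvPolynomial (Fin N) K →ₐ[K] K) (s k g) =
      (MvPolynomial.aeval a : MvPolynomial (Fin N) K →ₐ[K] K) g
    rw [← AlgHom.comp_apply]
    congr 1
    refine MvPolynomial.algHom_ext fun i => ?_
    by_cases hi : (i : ℕ) < k <;> simp [s, hi]
  let q : ℕ → {p : Ideal (MvPolynomial (Fin N) K) // p.IsPrime ∧
      Disjoint (Submonoid.powers g : Set (MvPolynomial (Fin N) K)) p} := fun k =>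
    ⟨RingHom.ker (s k), RingHom.ker_isPrime _, Set.disjoint_left.2 (by
      rintro _ ⟨l, rfl⟩ h
      have h' : s k g ^ l = 0 := by
        rw [← map_pow]
        exact h
      exact heval k (by rw [eq_zero_of_pow_eq_zero h', map_zero]))⟩
  have hq : ∀ k < N, q k < q (k + 1) := by
    intro k hk
    refine lt_of_le_of_ne (fun y hy => ?_) fun h => ?_
    · change s (k + 1) y = 0
      rw [← hs, show s k y = 0 from hy, map_zero]
    · have h1 : MvPolynomial.X ⟨k, hk⟩ - MvPolynomial.C (a ⟨k, hk⟩) ∈ (q (k + 1)).1 := by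
        change s (k + 1) _ = 0
        simp [s, ← MvPolynomial.algebraMap_eq]
      rw [← h] at h1
      have h2 : s k (MvPolynomial.X ⟨k, hk⟩ - MvPolynomial.C (a ⟨k, hk⟩)) = 0 := h1
      have h3 := congrArg (MvPolynomial.eval (a + 1)) h2
      simp [s, ← MvPolynomial.algebraMap_eq] at h3
  let e := (IsLocalization.orderIsoOfPrime (Submonoid.powers g) (Localization.Away g)).symm
  let S : LTSeries (PrimeSpectrum (Localization.Away g)) :=
    { length := N
      toFun := fun k => ⟨(e (q k)).1, (e (q k)).2⟩
      step := fun k => e.strictMono (hq k k.2) }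
  exact Order.LTSeries.length_le_krullDim S

theorem ringKrullDim_away_eq {σ : Type*} [Finite σ] (g : MvPolynomial σ K) (a : σ → K)
    (ha : MvPolynomial.eval a g ≠ 0) : ringKrullDim (Localization.Away g) = Nat.card σ := by
  refine le_antisymm (ringKrullDim_away_le g) ?_
  let e := Finite.equivFin σ
  let φ := MvPolynomial.renameEquiv K e
  have h := le_ringKrullDim_away (φ g) (a ∘ e.symm) (by
    simpa [φ, MvPolynomial.eval_rename, Function.comp_assoc] using ha)
  refine h.trans (ringKrullDim_eq_of_ringEquiv
    (IsLocalization.ringEquivOfRingEquiv (M := Submonoid.powers g) (T := Submonoid.powers (φ g))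
      (Localization.Away g) (Localization.Away (φ g)) φ.toRingEquiv (by simp))).ge

end Dimension

/-! ### Dimensions of boundaries, cycles and homology -/

section Homology

variable {K : Type*} [Field K] {n : ℕ} {V : Fin (n + 1) → Type*}
  [∀ i, AddCommGroup (V i)] [∀ i, Module K (V i)] {r : Fin n → ℕ} {f : MapSeq K V}

theorem extendRank_of_lt {j : ℕ} (hj : n < j) : extendRank r j = 0 := by
  cases j with
  | zero => rfl
  | succ j =>
    have : ¬ j < n := by omega
    simp [extendRank, this]

theorem finrank_boundaries (hf : f ∈ rankStratum K V r) (v : Fin (n + 1)) :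
    Module.finrank K (boundaries f v) = extendRank r v := by
  cases v using Fin.cases with
  | zero => exact finrank_bot K (V 0)
  | succ i => exact (hf.2 i).trans (extendRank_succ r i).symm

theorem finrank_cycles_add [∀ i, FiniteDimensional K (V i)] (hf : f ∈ rankStratum K V r)
    (v : Fin (n + 1)) :
    Module.finrank K (cycles f v) + extendRank r (v + 1) = Module.finrank K (V v) := by
  cases v using Fin.lastCases with
  | last =>
    rw [cycles, Fin.lastCases_last, finrank_top, extendRank_of_lt (by simp)]
    rfl
  | cast i =>
    rw [cycles, Fin.lastCases_castSucc, ← (f i).finrank_range_add_finrank_ker, hf.2 i, add_comm]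
    congr 1
    exact extendRank_succ r i

theorem boundaries_le_cycles (hf : f ∈ complexes K V) (v : Fin (n + 1)) :
    boundaries f v ≤ cycles f v := by
  cases v using Fin.lastCases with
  | last =>
    rw [cycles, Fin.lastCases_last]
    exact le_top
  | cast i =>
    rw [cycles, Fin.lastCases_castSucc]
    obtain ⟨i, hi⟩ := i
    cases i with
    | zero => exact bot_le (a := LinearMap.ker (f ⟨0, hi⟩))
    | succ i =>
      rintro _ ⟨x, rfl⟩
      exact hf i hi x

theorem homologyDim_add [∀ i, FiniteDimensional K (V i)] (hf : f ∈ rankStratum K V r)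
    (v : Fin (n + 1)) : homologyDim f v + (extendRank r (v + 1) + extendRank r v) =
      Module.finrank K (V v) := by
  have h := Submodule.finrank_quotient_add_finrank ((boundaries f v).submoduleOf (cycles f v))
  rw [(Submodule.submoduleOfEquivOfLe (boundaries_le_cycles hf.1 v)).finrank_eq,
    finrank_boundaries hf] at h
  have h' := finrank_cycles_add hf v
  rw [homologyDim]
  omega

/-- The ranks of a complex satisfy the inequalities, over any field. -/
theorem extendRank_add_le {d : Fin (n + 1) → ℕ} (b : ∀ i, Module.Basis (Fin (d i)) K (V i))
    (hf : f ∈ rankStratum K V r) (v : Fin (n + 1)) :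
    extendRank r (v + 1) + extendRank r v ≤ d v := by
  have : ∀ i, FiniteDimensional K (V i) := fun i => Module.Finite.of_basis (b i)
  have h := homologyDim_add hf v
  rw [Module.finrank_eq_card_basis (b v), Fintype.card_fin] at h
  omega

end Homology

/-! ### The dimension formulas -/

section Sums

variable {n : ℕ} {d : Fin (n + 1) → ℕ} {m : ℕ → ℕ}

theorem card_paramIdx (hm : m (n + 1) = 0) (h : ∀ v : Fin (n + 1), m (v + 1) + m v ≤ d v) :
    (Nat.card (ParamIdx d m) : ℚ) =
      ∑ v : Fin (n + 1), ((d v : ℚ) - m v) * ((m (v + 1) : ℚ) + m v) := by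
  have hle : ∀ v : Fin (n + 1), m v ≤ d v := fun v => by
    have := h v
    omega
  simp only [Nat.card_eq_fintype_card, Fintype.card_sum, Fintype.card_sigma, Fintype.card_prod,
    Fintype.card_fin, Nat.cast_add, Nat.cast_sum, Nat.cast_mul, Nat.cast_sub (hle _)]
  simp only [mul_add, Finset.sum_add_distrib]
  rw [add_comm]
  congr 1
  rw [Fin.sum_univ_castSucc (fun v : Fin (n + 1) => ((d v : ℚ) - m v) * (m (v + 1) : ℚ))]
  simp [hm, mul_comm]

theorem sum_mul_eq_half_sum_sq (hm0 : m 0 = 0) (hm : m (n + 1) = 0) (h : Fin (n + 1) → ℕ)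
    (hh : ∀ v : Fin (n + 1), h v + (m (v + 1) + m v) = d v) :
    ∑ v : Fin (n + 1), ((d v : ℚ) - m v) * ((m (v + 1) : ℚ) + m v) =
      1 / 2 * ∑ v : Fin (n + 1), ((d v : ℚ) ^ 2 - (h v : ℚ) ^ 2) := by
  -- The difference of the two sides is half the telescoping sum of `m (v + 1) ^ 2 - m v ^ 2`.
  have htel : ∑ v : Fin (n + 1), ((m (v + 1) : ℚ) ^ 2 - (m v : ℚ) ^ 2) = 0 := by
    rw [Fin.sum_univ_eq_sum_range (fun j => (m (j + 1) : ℚ) ^ 2 - (m j : ℚ) ^ 2),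
      Finset.sum_range_sub (fun j => (m j : ℚ) ^ 2), hm, hm0]
    simp
  have h' : ∀ v : Fin (n + 1), (d v : ℚ) = h v + (m (v + 1) + m v) := fun v => by
    rw [← hh v]
    push_cast
    ring
  rw [Finset.mul_sum, ← sub_eq_zero, ← Finset.sum_sub_distrib, ← mul_zero (1 / 2 : ℚ), ← htel,
    Finset.mul_sum]
  refine Finset.sum_congr rfl fun v _ => ?_
  rw [h' v]
  ring

end Sums

/-! ### Dimension and nonemptiness of the variety of complexes -/

section Stratum

universe u v

open AlgebraicGeometry CategoryTheory

variable {K : Type u} [Field K] {n : ℕ} {V : Fin (n + 1) → Type v}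
  [∀ i, AddCommGroup (V i)] [∀ i, Module K (V i)] {d : Fin (n + 1) → ℕ}
  (b : ∀ i, Module.Basis (Fin (d i)) K (V i)) {r : Fin n → ℕ}

theorem rankStratum_nonempty (b : ∀ i, Module.Basis (Fin (d i)) K (V i))
    (h : ∀ v : Fin (n + 1), extendRank r (v + 1) + extendRank r v ≤ d v) :
    (rankStratum K V r).Nonempty := by
  refine ⟨_, (toLin_mem_rankStratum_iff b r
    ((Chart.standard h).maps (Chart.standardParam K d (extendRank r)))).2
    ⟨Chart.isComplex_maps _ _, fun i => ?_⟩⟩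
  rw [Chart.rank_maps _ _ (Chart.pivotDet_standard K h), extendRank_succ]

theorem eval_standardParam_ne_zero
    (h : ∀ v : Fin (n + 1), extendRank r (v + 1) + extendRank r v ≤ d v) :
    MvPolynomial.eval (Chart.standardParam K d (extendRank r))
      ((Chart.standard h).coordHom K ((Chart.standard h).pivotElt K)) ≠ 0 := by
  rw [Chart.comp_coordHom_pivotElt]
  have hX : MvPolynomial.eval (Chart.standardParam K d (extendRank r)) ∘ MvPolynomial.X =
      Chart.standardParam K d (extendRank r) := funext fun z => MvPolynomial.eval_X z
  rw [hX]
  exact Chart.pivotDet_standard K h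

theorem coordHom_standard_ne_zero
    (h : ∀ v : Fin (n + 1), extendRank r (v + 1) + extendRank r v ≤ d v) :
    (Chart.standard h).coordHom K ((Chart.standard h).pivotElt K) ≠ 0 := fun h0 =>
  eval_standardParam_ne_zero (K := K) h (by rw [h0, map_zero])

theorem stratum_nonempty (h : ∀ v : Fin (n + 1), extendRank r (v + 1) + extendRank r v ≤ d v) :
    Nonempty (stratum b r) := by
  have := IsLocalization.Away.isDomain (S := (Chart.standard h).AwayRing K)
    (coordHom_standard_ne_zero (K := K) h)
  have : Nonempty (PrimeSpectrum ((Chart.standard h).AwayRing K)) := inferInstance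
  exact this.map ((Chart.standard h).toStratum b (coordHom_standard_ne_zero h))

theorem extendRank_add_le_of_mem_stratumPoints {p : PrimeSpectrum (CoordRing K d)}
    (hp : p ∈ stratumPoints b r) (v : Fin (n + 1)) :
    extendRank r (v + 1) + extendRank r v ≤ d v :=
  extendRank_add_le (fun i => (b i).baseChange p.asIdeal.ResidueField) hp v

theorem topologicalKrullDim_stratum
    (h : ∀ v : Fin (n + 1), extendRank r (v + 1) + extendRank r v ≤ d v) :
    topologicalKrullDim (stratum b r) = (Nat.card (ParamIdx d (extendRank r)) : WithBot ℕ∞) := by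
  apply le_antisymm
  · refine topologicalKrullDim_le_of_forall_exists_isOpenEmbedding _ fun x => ?_
    obtain ⟨c, hc, y, hy⟩ := exists_toStratum_eq b x
    refine ⟨PrimeSpectrum (c.AwayRing K), inferInstance, c.toStratum b hc,
      (c.toStratum b hc).isOpenEmbedding, ⟨y, hy⟩, ?_⟩
    rw [PrimeSpectrum.topologicalKrullDim_eq_ringKrullDim]
    exact ringKrullDim_away_le _
  · rw [← ringKrullDim_away_eq _ _ (eval_standardParam_ne_zero (K := K) h),
      ← PrimeSpectrum.topologicalKrullDim_eq_ringKrullDim]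
    exact ((Chart.standard h).toStratum b
      (coordHom_standard_ne_zero h)).isOpenEmbedding.isInducing.topologicalKrullDim_le

end Stratum

end VarietyOfComplexes

end

open VarietyOfComplexes in
theorem proposition2 {K : Type*} [Field K] {n : ℕ} {V : Fin (n + 1) → Type*}
    [∀ i, AddCommGroup (V i)] [∀ i, Module K (V i)] {d : Fin (n + 1) → ℕ}
    (b : ∀ i, Module.Basis (Fin (d i)) K (V i)) (r : Fin n → ℕ) :
    ((rankStratum K V r).Nonempty ↔
      ∀ i : Fin (n + 1), extendRank r (i + 1) + extendRank r i ≤ d i) ∧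
    (Nonempty (stratum b r) ↔
      ∀ i : Fin (n + 1), extendRank r (i + 1) + extendRank r i ≤ d i) ∧
    ((∀ i : Fin (n + 1), extendRank r (i + 1) + extendRank r i ≤ d i) →
      AlgebraicGeometry.Smooth (stratumToSpec b r) ∧
      IrreducibleSpace (stratum b r) ∧
      ∃ D : ℕ, topologicalKrullDim (stratum b r) = (D : WithBot ℕ∞) ∧
        (D : ℚ) = ∑ i : Fin (n + 1), ((d i : ℚ) - extendRank r i) *
          ((extendRank r (i + 1) : ℚ) + extendRank r i) ∧
        ∀ f ∈ rankStratum K V r,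
          (D : ℚ) = ∑ i : Fin (n + 1), ((d i : ℚ) - extendRank r i) *
            ((d i : ℚ) - homologyDim f i) ∧
          (D : ℚ) = 1 / 2 * ∑ i : Fin (n + 1), ((d i : ℚ) ^ 2 - (homologyDim f i : ℚ) ^ 2)) := by
  refine ⟨⟨fun ⟨f, hf⟩ => extendRank_add_le b hf, rankStratum_nonempty b⟩,
    ⟨fun ⟨x⟩ => extendRank_add_le_of_mem_stratumPoints b x.2, stratum_nonempty b⟩, fun h => ?_⟩
  have hne := stratum_nonempty b h
  have hlast : extendRank r (n + 1) = 0 := extendRank_of_lt (Nat.lt_succ_self n)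
  have hD := card_paramIdx hlast h
  refine ⟨smooth_stratumToSpec b, ?_, Nat.card (ParamIdx d (extendRank r)),
    topologicalKrullDim_stratum b h, hD, fun f hf => ?_⟩
  · obtain ⟨x⟩ := id hne
    exact irreducibleSpace_stratum b (Chart.standard h) ⟨_, x.2⟩
  · have : ∀ i, FiniteDimensional K (V i) := fun i => Module.Finite.of_basis (b i)
    have hh : ∀ v : Fin (n + 1),
        homologyDim f v + (extendRank r (v + 1) + extendRank r v) = d v := fun v => by
      rw [homologyDim_add hf v, Module.finrank_eq_card_basis (b v), Fintype.card_fin]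
    refine ⟨?_, hD.trans (sum_mul_eq_half_sum_sq rfl hlast _ hh)⟩
    rw [hD]
    refine Finset.sum_congr rfl fun v _ => ?_
    rw [← hh v]
    push_cast
    ring
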